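/- A rectilinear polygon is a compact region $C\subset\mathbb{R}^2$ (the closure of its connected interior) whose boundary is a simple closed polygonal chain with axis-parallel edges, consecutive edges being perpendicular; a vertex is reflex if its interior angle is $270^\circ$. A value-density on $C$ is an integrable, non-negative, bounded function $v$ on $C$, and the corresponding value of a piece $X\subseteq C$ is $V(X)=\int_X v(x)\,dx$. A rectangular allocation of $C$ to $n$ agents is a vector $(X_1,\dots,X_n)$ of pairwise disjoint axis-parallel rectangles (products of two intervals of positive length) contained in $C$; part of $C$ may remain unallocated. Let $n\ge 1$ and $R\ge 0$ be integers. 1. Let $C$ be a rectilinear polygon with exactly $R$ reflex vertices, and let $n$ agents have value-densities $v_1,\dots,v_n$ on $C$ with values $V_1,\dots,V_n$. Then there is a rectangular allocation $(X_1,\dots,X_n)$ of $C$ with $$V_i(X_i)\ \ge\ \frac{V_i(C)}{n+R}\qquad\text{for all } i=1,\dots,n.$$ 2. The fraction $1/(n+R)$ is the largest that can be guaranteed: it is the greatest real $c$ such that for every rectilinear polygon $C$ with exactly $R$ reflex vertices and all value-densities $v_1,\dots,v_n$ on $C$ there is a rectangular allocation with $V_i(X_i)\ge c\,V_i(C)$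 for all $i$. This is shown by a staircase: the set $C=\bigcup_{k=0}^{R}[0,k+1]\times[0,R+1-k]$ is a rectilinear polygon with exactly $R$ reflex vertices, and there is a value-density on $C$ with $V(C)>0$ such that, if all $n$ agents have this value-density, then in every rectangular allocation of $C$ some agent $i$ has $V(X_i)\le V(C)/(n+R)$. -/

import Mathlib

open Set Filter Topology MeasureTheory

noncomputable section

/-- The closed polygonal chain `P` is a simple closed curve all of whose edges are axis-parallel
and whose consecutive edges are perpendicular. Two distinct edges that are not consecutive are
disjoint; consecutive ones, being perpendicular, meet only in their common vertex. -/
structure IsSimpleRectilinearChain {N : ℕ} (P : Polygon (ℝ × ℝ) N) : Prop where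
  nondegenerate : P.HasNondegenerateEdges
  perpendicular : ∀ i : Fin N,
    ((P i).1 = (P (finRotate N i)).1 ∧
        (P (finRotate N i)).2 = (P (finRotate N (finRotate N i))).2) ∨
      ((P i).2 = (P (finRotate N i)).2 ∧
        (P (finRotate N i)).1 = (P (finRotate N (finRotate N i))).1)
  simple : ∀ i j : Fin N, i ≠ j → j ≠ finRotate N i → i ≠ finRotate N j →
    Disjoint (P.edgeSet ℝ i) (P.edgeSet ℝ j)

/-- A rectilinear polygon (with its inside): a compact region of the plane, i.e. the closure of
its connected interior, whose boundary is a simple closed axis-parallel polygonal chain. -/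
structure IsRectilinearPolygon (C : Set (ℝ × ℝ)) : Prop where
  compact : IsCompact C
  regular : closure (interior C) = C
  connected : IsConnected (interior C)
  boundary : ∃ (N : ℕ) (P : Polygon (ℝ × ℝ) N),
    IsSimpleRectilinearChain P ∧ frontier C = P.boundary ℝ

/-- The reflex vertices of a rectilinear polygon: the points at which its interior angle is 270°,
i.e. near `p` the set `C` is the complement of one of the four open quadrants with apex `p`. -/
def reflexVertices (C : Set (ℝ × ℝ)) : Set (ℝ × ℝ) :=
  {p | ∃ s t : ℝ, (s = 1 ∨ s = -1) ∧ (t = 1 ∨ t = -1) ∧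
    ∀ᶠ q in 𝓝 p, (q ∈ C ↔ 0 ≤ s * (q.1 - p.1) ∨ 0 ≤ t * (q.2 - p.2))}

/-- A value-density on `C`: integrable, non-negative and bounded on `C`. -/
structure IsValueDensity (C : Set (ℝ × ℝ)) (v : ℝ × ℝ → ℝ) : Prop where
  integrable : IntegrableOn v C
  nonneg : ∀ x ∈ C, 0 ≤ v x
  bounded : ∃ M : ℝ, ∀ x ∈ C, v x ≤ M

/-- The value of the piece `X` under the value-density `v`. -/
def pieceValue (v : ℝ × ℝ → ℝ) (X : Set (ℝ × ℝ)) : ℝ := ∫ x in X, v x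

/-- An axis-parallel rectangle: a product of two intervals (open, closed or half-open) of
positive length. -/
def IsRectangle (X : Set (ℝ × ℝ)) : Prop :=
  ∃ I J : Set ℝ, I.OrdConnected ∧ J.OrdConnected ∧ I.Nontrivial ∧ J.Nontrivial ∧ X = I ×ˢ J

/-- One rectangular piece of `C` for each agent, the pieces being pairwise disjoint; part of `C`
may remain unallocated. -/
structure IsRectangularAllocation {n : ℕ} (C : Set (ℝ × ℝ)) (X : Fin n → Set (ℝ × ℝ)) :
    Prop where
  rectangle : ∀ i, IsRectangle (X i)
  subset : ∀ i, X i ⊆ C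
  disjoint : ∀ i j, i ≠ j → Disjoint (X i) (X j)

/-- The fraction `c` of the total value can be guaranteed to each of `n` agents, for every
rectilinear polygon with exactly `R` reflex vertices and all value-densities of the agents. -/
def CanGuarantee (n R : ℕ) (c : ℝ) : Prop :=
  ∀ C : Set (ℝ × ℝ), IsRectilinearPolygon C → (reflexVertices C).encard = R →
    ∀ v : Fin n → ℝ × ℝ → ℝ, (∀ i, IsValueDensity C (v i)) →
      ∃ X : Fin n → Set (ℝ × ℝ), IsRectangularAllocation C X ∧
        ∀ i, c * pieceValue (v i) C ≤ pieceValue (v i) (X i)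

/-- The staircase with `R + 1` stairs of width and height one. -/
def staircase (R : ℕ) : Set (ℝ × ℝ) :=
  ⋃ k ∈ Finset.range (R + 1), Icc (0 : ℝ) ((k : ℝ) + 1) ×ˢ Icc (0 : ℝ) ((R : ℝ) + 1 - (k : ℝ))

end

/-! Guarantee: overlay `C` with a grid through its vertices, so that `C` becomes, up to a null set,
a finite edge-connected set of cells. Cut this set along the horizontal lines issuing from its
reflex corners. The resulting pieces are rectangles. Join two pieces by an edge when a reflex block
witnesses that they touch vertically. This graph is connected and each reflex block yields at most
one edge, so there are at most `R + 1` pieces (`ncard_cellPiece_le`,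
`IsRectilinearPolygon.exists_box_partition`).

The pieces are then shared by a moving knife (`exists_boxes_of_list`). Suppose `a` agents face `m`
boxes and each values their union at `a + m - 1` thresholds or more. If nobody finds the first box
worth a threshold, discard it: everybody loses less than one threshold and `m` drops by one.
Otherwise cut off the smallest slice that some agent accepts and give it to that agent: everybody
else loses at most one threshold and `a` drops by one. With `a = n` and `m ≤ R + 1` the threshold
`V(C) / (n + R)` is affordable.

Optimality: on the staircase, put weight one on a unit square at each outer corner except the last,
which gets weight `n`; the total is `n + R`. A rectangle inside the staircase meets at most one of
these squares. A piece worth more than one must therefore draw its value from the last square, and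
`n` disjoint pieces share at most `n` there, so some agent gets at most one
(`exists_pieceValue_cornerDensity_le`). -/

/-! ### Cutting a set of grid cells into rectangles -/

/-- The maximal horizontal run of cells of `S` through the cell `(i, j)`. -/
def cellRun (S : Set (ℕ × ℕ)) (i j : ℕ) : Set ℕ :=
  ordConnectedComponent {k | (k, j) ∈ S} i

/-- The maximal interval of rows around `j` in which the run through column `i` is the same. -/
def rowRun (S : Set (ℕ × ℕ)) (i j : ℕ) : Set ℕ :=
  ordConnectedComponent {j' | cellRun S i j' = cellRun S i j} j

/-- The rectangle of cells (columns and rows) to which the cell `s` belongs when `S` is cut along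
all horizontal lines that start at its reflex corners. -/
def cellPiece (S : Set (ℕ × ℕ)) (s : ℕ × ℕ) : Set ℕ × Set ℕ :=
  (cellRun S s.1 s.2, rowRun S s.1 s.2)

/-- The `2 × 2` blocks of cells (given by their lower left cell) of which exactly three cells
belong to `S`. -/
def reflexBlocks (S : Set (ℕ × ℕ)) : Set (ℕ × ℕ) :=
  {c | (((c.1, c.2) ∈ S ∧ (c.1, c.2 + 1) ∈ S) ∧ Xor ((c.1 + 1, c.2) ∈ S) ((c.1 + 1, c.2 + 1) ∈ S)) ∨
    (((c.1 + 1, c.2) ∈ S ∧ (c.1 + 1, c.2 + 1) ∈ S) ∧ Xor ((c.1, c.2) ∈ S) ((c.1, c.2 + 1) ∈ S))}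

/-- Connectedness of a set of cells with respect to edge-adjacency. -/
def CellConnected (S : Set (ℕ × ℕ)) : Prop :=
  ∀ K : Set (ℕ × ℕ), (S ∩ K).Nonempty →
    (∀ i j, (i, j) ∈ S → (i + 1, j) ∈ S → ((i, j) ∈ K ↔ (i + 1, j) ∈ K)) →
    (∀ i j, (i, j) ∈ S → (i, j + 1) ∈ S → ((i, j) ∈ K ↔ (i, j + 1) ∈ K)) → S ⊆ K

section Pieces

variable {S : Set (ℕ × ℕ)} {i j k : ℕ}

lemma mem_cellRun_self (h : (i, j) ∈ S) : i ∈ cellRun S i j :=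
  self_mem_ordConnectedComponent.2 h

lemma mem_rowRun_self : j ∈ rowRun S i j :=
  self_mem_ordConnectedComponent.2 rfl

lemma cellRun_eq_of_mem (h : k ∈ cellRun S i j) : cellRun S k j = cellRun S i j :=
  (ordConnectedComponent_eq h).symm

/-- A row with the same run through `i` has a run containing `k`, and conversely. So the rows
compared in `rowRun` do not depend on which column of the run is used. -/
lemma rowRun_eq_of_mem_cellRun (h : k ∈ cellRun S i j) : rowRun S k j = rowRun S i j := by
  have : {j' | cellRun S k j' = cellRun S k j} = {j' | cellRun S i j' = cellRun S i j} := by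
    ext j'
    simp only [mem_ofPred_eq]
    rw [cellRun_eq_of_mem h]
    constructor
    · intro e
      have hi : i ∈ cellRun S k j' := by
        rw [e]
        exact self_mem_ordConnectedComponent.2 (h left_mem_uIcc)
      rw [cellRun_eq_of_mem hi, e]
    · intro e
      have hk : k ∈ cellRun S i j' := by rwa [e]
      rw [cellRun_eq_of_mem hk, e]
  rw [rowRun, rowRun, this]

lemma cellPiece_eq_of_mem_cellRun (h : k ∈ cellRun S i j) :
    cellPiece S (k, j) = cellPiece S (i, j) :=
  Prod.ext (cellRun_eq_of_mem h) (rowRun_eq_of_mem_cellRun h)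

lemma cellPiece_eq_of_mem_rowRun (h : k ∈ rowRun S i j) :
    cellPiece S (i, k) = cellPiece S (i, j) := by
  have h1 : cellRun S i k = cellRun S i j := h right_mem_uIcc
  refine Prod.ext h1 ?_
  change rowRun S i k = rowRun S i j
  rw [rowRun, h1]
  exact (ordConnectedComponent_eq h).symm

lemma mem_prod_cellPiece {s : ℕ × ℕ} (hs : s ∈ S) :
    s ∈ (cellPiece S s).1 ×ˢ (cellPiece S s).2 :=
  ⟨mem_cellRun_self hs, mem_rowRun_self⟩

/-- All rows of a piece have the same run, so the full product of columns and rows stays inside `S`.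
This makes the pieces rectangles, and it shows that those that overlap coincide. -/
lemma mem_of_mem_prod_cellPiece {s t : ℕ × ℕ} (h : t ∈ (cellPiece S s).1 ×ˢ (cellPiece S s).2) :
    t ∈ S ∧ cellPiece S t = cellPiece S s := by
  obtain ⟨i, j⟩ := s
  obtain ⟨k, l⟩ := t
  obtain ⟨h1, h2⟩ := h
  simp only [cellPiece] at h1 h2
  have e : cellRun S i l = cellRun S i j := h2 right_mem_uIcc
  rw [← e] at h1
  exact ⟨h1 right_mem_uIcc, (cellPiece_eq_of_mem_cellRun h1).trans (cellPiece_eq_of_mem_rowRun h2)⟩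

lemma succ_mem_cellRun (h : i ≤ k) :
    k + 1 ∈ cellRun S i j ↔ k ∈ cellRun S i j ∧ (k + 1, j) ∈ S := by
  simp only [cellRun, mem_ordConnectedComponent, uIcc_of_le h, uIcc_of_le (h.trans k.le_succ)]
  refine ⟨fun H => ⟨fun m hm => H ⟨hm.1, hm.2.trans k.le_succ⟩, H ⟨h.trans k.le_succ, le_rfl⟩⟩, ?_⟩
  rintro ⟨H1, H2⟩ m hm
  rcases Nat.le_succ_iff.1 hm.2 with h' | h'
  · exact H1 ⟨hm.1, h'⟩
  · exact h' ▸ H2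

lemma mem_cellRun_of_succ_le (h : k + 1 ≤ i) :
    k ∈ cellRun S i j ↔ k + 1 ∈ cellRun S i j ∧ (k, j) ∈ S := by
  simp only [cellRun, mem_ordConnectedComponent, uIcc_of_ge h, uIcc_of_ge (k.le_succ.trans h)]
  refine ⟨fun H => ⟨fun m hm => H ⟨k.le_succ.trans hm.1, hm.2⟩, H ⟨le_rfl, k.le_succ.trans h⟩⟩, ?_⟩
  rintro ⟨H1, H2⟩ m hm
  rcases Nat.eq_or_lt_of_le hm.1 with h' | h'
  · exact h' ▸ H2
  · exact H1 ⟨h', hm.2⟩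

/-- The pieces of the two vertically adjacent cells in the full column of a reflex block. -/
noncomputable def blockEdge (S : Set (ℕ × ℕ)) (c : ℕ × ℕ) : Sym2 (Set ℕ × Set ℕ) :=
  open Classical in
  if (c.1, c.2) ∈ S ∧ (c.1, c.2 + 1) ∈ S then s(cellPiece S (c.1, c.2), cellPiece S (c.1, c.2 + 1))
  else s(cellPiece S (c.1 + 1, c.2), cellPiece S (c.1 + 1, c.2 + 1))

/-- Follow the runs of rows `j` and `j + 1` to the right and to the left of column `i`. If at some
column one continues and the other stops, the block there has exactly three cells. If this never
happens, the two runs agree and the cells lie in the same piece. -/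
lemma exists_reflexBlock_of_cellPiece_ne (h1 : (i, j) ∈ S) (h2 : (i, j + 1) ∈ S)
    (hne : cellPiece S (i, j) ≠ cellPiece S (i, j + 1)) :
    ∃ c ∈ reflexBlocks S, blockEdge S c = s(cellPiece S (i, j), cellPiece S (i, j + 1)) := by
  by_contra! H
  have hup : ∀ k, i ≤ k → (k ∈ cellRun S i j ↔ k ∈ cellRun S i (j + 1)) := by
    intro k hk
    induction k, hk using Nat.le_induction with
    | base => simp [mem_cellRun_self h1, mem_cellRun_self h2]
    | succ k hk ih =>
      rw [succ_mem_cellRun hk, succ_mem_cellRun hk, ← ih]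
      refine and_congr_right fun hk1 => ?_
      have hk2 := ih.1 hk1
      have m1 : (k, j) ∈ S := hk1 right_mem_uIcc
      have m2 : (k, j + 1) ∈ S := hk2 right_mem_uIcc
      by_contra hx
      refine H (k, j) (Or.inl ⟨⟨m1, m2⟩, (xor_iff_not_iff _ _).2 hx⟩) ?_
      rw [blockEdge, if_pos ⟨m1, m2⟩, cellPiece_eq_of_mem_cellRun hk1,
        cellPiece_eq_of_mem_cellRun hk2]
  have hdown : ∀ k, k ≤ i → (k ∈ cellRun S i j ↔ k ∈ cellRun S i (j + 1)) := by
    intro k hk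
    induction hk using Nat.decreasingInduction with
    | self => simp [mem_cellRun_self h1, mem_cellRun_self h2]
    | of_succ k hk ih =>
      rw [mem_cellRun_of_succ_le hk, mem_cellRun_of_succ_le hk, ← ih]
      refine and_congr_right fun hk1 => ?_
      have hk2 := ih.1 hk1
      have m1 : (k + 1, j) ∈ S := hk1 right_mem_uIcc
      have m2 : (k + 1, j + 1) ∈ S := hk2 right_mem_uIcc
      by_contra hx
      refine H (k, j) (Or.inr ⟨⟨m1, m2⟩, (xor_iff_not_iff _ _).2 hx⟩) ?_
      -- With both left cells in `S` the memberships would agree, so here the full column is the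
      -- right one.
      rw [blockEdge, if_neg fun h => hx (by simp [h.1, h.2]), cellPiece_eq_of_mem_cellRun hk1,
        cellPiece_eq_of_mem_cellRun hk2]
  have e : cellRun S i j = cellRun S i (j + 1) := by
    ext k
    exact (le_total i k).elim (hup k) (hdown k)
  refine hne (cellPiece_eq_of_mem_rowRun (k := j + 1) ?_).symm
  intro m hm
  rw [uIcc_of_le j.le_succ] at hm
  rcases Nat.le_succ_iff.1 hm.2 with h' | h'
  · rw [le_antisymm h' hm.1]; rfl
  · rw [h']; exact e.symm

/-- The pieces of a connected set of cells, adjacent when they share an edge. -/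
def pieceGraph (S : Set (ℕ × ℕ)) : SimpleGraph (cellPiece S '' S) where
  Adj P Q := P ≠ Q ∧ s(P.1, Q.1) ∈ blockEdge S '' reflexBlocks S
  symm := ⟨fun _ _ h => ⟨h.1.symm, Sym2.eq_swap ▸ h.2⟩⟩
  loopless := ⟨fun _ h => h.1 rfl⟩

/-- Cells sharing a vertical side lie in the same piece; cells sharing a horizontal side lie in
equal or adjacent pieces. Hence the cells whose piece is reachable from a fixed one form a set
closed under adjacency. -/
lemma pieceGraph_connected (hS : S.Nonempty) (hc : CellConnected S) : (pieceGraph S).Connected := by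
  obtain ⟨s₀, hs₀⟩ := hS
  let P₀ : cellPiece S '' S := ⟨cellPiece S s₀, s₀, hs₀, rfl⟩
  have key : S ⊆ {s | ∃ h : s ∈ S, (pieceGraph S).Reachable P₀ ⟨cellPiece S s, s, h, rfl⟩} := by
    apply hc
    · exact ⟨s₀, hs₀, hs₀, SimpleGraph.Reachable.refl _⟩
    · intro i j h1 h2
      have e : cellPiece S (i + 1, j) = cellPiece S (i, j) :=
        cellPiece_eq_of_mem_cellRun ((succ_mem_cellRun le_rfl).2 ⟨mem_cellRun_self h1, h2⟩)
      simp only [mem_ofPred_eq, h1, h2, exists_true_left, e]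
    · intro i j h1 h2
      simp only [mem_ofPred_eq, h1, h2, exists_true_left]
      by_cases e : cellPiece S (i, j) = cellPiece S (i, j + 1)
      · simp only [e]
      · obtain ⟨c, hc, hce⟩ := exists_reflexBlock_of_cellPiece_ne h1 h2 e
        have ha : (pieceGraph S).Adj ⟨cellPiece S (i, j), _, h1, rfl⟩
            ⟨cellPiece S (i, j + 1), _, h2, rfl⟩ :=
          ⟨fun h => e (congrArg Subtype.val h), c, hc, hce⟩
        exact ⟨fun h => h.trans ha.reachable, fun h => h.trans ha.symm.reachable⟩
  have : Nonempty (cellPiece S '' S) := ⟨P₀⟩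
  refine ⟨fun P Q => ?_⟩
  obtain ⟨_, s, hs, rfl⟩ := P
  obtain ⟨_, t, ht, rfl⟩ := Q
  exact (key hs).2.symm.trans (key ht).2

/-- A connected set of cells with `R` reflex corners is cut into at most `R + 1` pieces. -/
theorem ncard_cellPiece_le (hS : S.Nonempty) (hc : CellConnected S)
    (hfin : (reflexBlocks S).Finite) :
    (cellPiece S '' S).ncard ≤ (reflexBlocks S).ncard + 1 := by
  -- A connected graph has at most one vertex more than it has edges, and all edges come from reflex
  -- blocks.
  refine (pieceGraph_connected hS hc).card_vert_le_card_edgeSet_add_one.trans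
    (Nat.add_le_add_right ?_ 1)
  change (pieceGraph S).edgeSet.ncard ≤ _
  have himg : Sym2.map Subtype.val '' (pieceGraph S).edgeSet ⊆ blockEdge S '' reflexBlocks S := by
    rintro _ ⟨e, he, rfl⟩
    induction e with
    | h P Q => exact he.2
  calc (pieceGraph S).edgeSet.ncard
      = (Sym2.map Subtype.val '' (pieceGraph S).edgeSet).ncard :=
        (ncard_image_of_injective _ (Sym2.map.injective Subtype.val_injective)).symm
    _ ≤ (blockEdge S '' reflexBlocks S).ncard := ncard_le_ncard himg (hfin.image _)
    _ ≤ (reflexBlocks S).ncard := ncard_image_le hfin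

end Pieces

/-! ### Sharing a list of boxes by a moving knife -/

/-- The half-open box with lower left corner `(a, c)` and upper right corner `(b, d)`, given as
`((a, b), (c, d))`. -/
def halfOpenBox (Q : (ℝ × ℝ) × (ℝ × ℝ)) : Set (ℝ × ℝ) :=
  Ioc Q.1.1 Q.1.2 ×ˢ Ioc Q.2.1 Q.2.2

lemma measurableSet_halfOpenBox (Q : (ℝ × ℝ) × (ℝ × ℝ)) : MeasurableSet (halfOpenBox Q) :=
  measurableSet_Ioc.prod measurableSet_Ioc

lemma halfOpenBox_union {a s b : ℝ} (J : ℝ × ℝ) (has : a ≤ s) (hsb : s ≤ b) :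
    halfOpenBox ((a, s), J) ∪ halfOpenBox ((s, b), J) = halfOpenBox ((a, b), J) := by
  simp only [halfOpenBox, ← union_prod, Ioc_union_Ioc_eq_Ioc has hsb]

lemma disjoint_halfOpenBox_adjacent (a s b : ℝ) (J : ℝ × ℝ) :
    Disjoint (halfOpenBox ((a, s), J)) (halfOpenBox ((s, b), J)) :=
  Disjoint.set_prod_left (Ioc_disjoint_Ioc_of_le le_rfl) _ _

lemma measureReal_halfOpenBox_split (μ : Measure (ℝ × ℝ)) [IsFiniteMeasure μ] {a s b : ℝ}
    (J : ℝ × ℝ) (has : a ≤ s) (hsb : s ≤ b) :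
    μ.real (halfOpenBox ((a, b), J)) =
      μ.real (halfOpenBox ((a, s), J)) + μ.real (halfOpenBox ((s, b), J)) := by
  rw [← halfOpenBox_union J has hsb,
    measureReal_union (disjoint_halfOpenBox_adjacent a s b J) (measurableSet_halfOpenBox _)]

/-- Disjoint boxes can be shared by a finite set `A` of agents so that every agent gets a box worth
at least `t i`, provided each agent values all boxes together at least `#A + #boxes - 1` times
`t i`. The values only have to depend continuously on the position of a vertical cut. -/
theorem exists_boxes_of_list {ι : Type*} (μ : ι → Measure (ℝ × ℝ)) [∀ i, IsFiniteMeasure (μ i)]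
    (hcont : ∀ i a J, ContinuousOn (fun s => (μ i).real (halfOpenBox ((a, s), J))) (Ici a))
    (t : ι → ℝ) (ht : ∀ i, 0 < t i) (k : ℕ) :
    ∀ (A : Finset ι) (L : List ((ℝ × ℝ) × (ℝ × ℝ))), A.card + L.length ≤ k → L ≠ [] →
      L.Pairwise (fun P Q => Disjoint (halfOpenBox P) (halfOpenBox Q)) →
      (∀ i ∈ A, t i * (A.card + L.length - 1) ≤ (L.map fun Q => (μ i).real (halfOpenBox Q)).sum) →
      ∃ X : ι → (ℝ × ℝ) × (ℝ × ℝ),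
        (∀ i ∈ A, ∃ Q ∈ L, halfOpenBox (X i) ⊆ halfOpenBox Q) ∧
        (∀ i ∈ A, ∀ j ∈ A, i ≠ j → Disjoint (halfOpenBox (X i)) (halfOpenBox (X j))) ∧
        ∀ i ∈ A, t i ≤ (μ i).real (halfOpenBox (X i)) := by
  classical
  -- Each move removes one agent or one box, so the sum of the two numbers is the induction measure.
  induction k with
  | zero =>
    intro A L hk hL
    exact absurd (List.length_eq_zero_iff.1 (by omega)) hL
  | succ k ih =>
    intro A L hk hL hd hv
    rcases A.eq_empty_or_nonempty with rfl | hA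
    · exact ⟨fun _ => 0, by simp⟩
    obtain ⟨⟨⟨a, b⟩, J⟩, L, rfl⟩ := List.exists_cons_of_ne_nil hL
    rw [List.pairwise_cons] at hd
    simp only [List.map_cons, List.sum_cons, List.length_cons, Nat.cast_add, Nat.cast_one] at hv hk
    by_cases hB : ∃ i ∈ A, t i ≤ (μ i).real (halfOpenBox ((a, b), J))
    · -- some agent accepts the first box: cut off the smallest acceptable slice
      have hab : a < b := by
        obtain ⟨i, -, hi⟩ := hB
        by_contra! hab
        simp only [halfOpenBox, Ioc_eq_empty hab.not_gt, empty_prod, measureReal_empty] at hi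
        exact absurd hi (ht i).not_ge
      have hcut : ∀ i, t i ≤ (μ i).real (halfOpenBox ((a, b), J)) →
          ∃ s ∈ Icc a b, (μ i).real (halfOpenBox ((a, s), J)) = t i := by
        intro i hi
        have := intermediate_value_Icc hab.le ((hcont i a J).mono Icc_subset_Ici_self)
        refine this ⟨?_, hi⟩
        simp [halfOpenBox, (ht i).le]
      choose! s hs hst using hcut
      have hne : (A.filter fun i => t i ≤ (μ i).real (halfOpenBox ((a, b), J))).Nonempty := by
        obtain ⟨i, hi, h⟩ := hB
        exact ⟨i, Finset.mem_filter.2 ⟨hi, h⟩⟩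
      obtain ⟨i₀, hi₀, hmin⟩ := Finset.exists_min_image _ s hne
      rw [Finset.mem_filter] at hi₀
      obtain ⟨hi₀A, hi₀t⟩ := hi₀
      obtain ⟨has, hsb⟩ := hs i₀ hi₀t
      -- An agent who accepts the whole box has its cut no earlier than `s i₀`; any other agent
      -- finds even the whole box too small.
      have hle : ∀ j ∈ A, (μ j).real (halfOpenBox ((a, s i₀), J)) ≤ t j := by
        intro j hj
        by_cases hjt : t j ≤ (μ j).real (halfOpenBox ((a, b), J))
        · rw [← hst j hjt]
          exact measureReal_mono (Set.prod_mono
            (Ioc_subset_Ioc_right (hmin j (Finset.mem_filter.2 ⟨hj, hjt⟩))) Subset.rfl)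
        · refine (measureReal_mono (Set.prod_mono ?_ Subset.rfl)).trans (not_le.1 hjt).le
          exact Ioc_subset_Ioc_right hsb
      have hsub : halfOpenBox ((s i₀, b), J) ⊆ halfOpenBox ((a, b), J) :=
        Set.prod_mono (Ioc_subset_Ioc_left has) Subset.rfl
      have hsub' : halfOpenBox ((a, s i₀), J) ⊆ halfOpenBox ((a, b), J) :=
        Set.prod_mono (Ioc_subset_Ioc_right hsb) Subset.rfl
      have hcard : (A.erase i₀).card + 1 = A.card := Finset.card_erase_add_one hi₀A
      obtain ⟨X, hX1, hX2, hX3⟩ := ih (A.erase i₀) (((s i₀, b), J) :: L)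
        (by simp only [List.length_cons]; omega) (List.cons_ne_nil _ _)
        (List.pairwise_cons.2 ⟨fun Q hQ => (hd.1 Q hQ).mono_left hsub, hd.2⟩)
        (by
          intro i hi
          have hiA := Finset.mem_of_mem_erase hi
          have h1 := hv i hiA
          have h2 := hle i hiA
          have h3 := measureReal_halfOpenBox_split (μ i) J has hsb
          rw [← hcard] at h1
          simp only [List.map_cons, List.sum_cons, List.length_cons, Nat.cast_add, Nat.cast_one]
            at h1 ⊢
          linarith)
      have hdisj : ∀ i ∈ A.erase i₀,
          Disjoint (halfOpenBox ((a, s i₀), J)) (halfOpenBox (X i)) := by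
        intro i hi
        obtain ⟨Q, hQ, hQs⟩ := hX1 i hi
        refine Disjoint.mono_right hQs ?_
        rcases List.mem_cons.1 hQ with rfl | hQ
        · exact disjoint_halfOpenBox_adjacent _ _ _ _
        · exact (hd.1 Q hQ).mono_left hsub'
      refine ⟨Function.update X i₀ ((a, s i₀), J), ?_, ?_, ?_⟩
      · intro i hi
        rcases eq_or_ne i i₀ with rfl | hne
        · exact ⟨_, List.mem_cons_self, by simpa using hsub'⟩
        · obtain ⟨Q, hQ, hQs⟩ := hX1 i (Finset.mem_erase.2 ⟨hne, hi⟩)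
          rw [Function.update_of_ne hne]
          rcases List.mem_cons.1 hQ with rfl | hQ
          · exact ⟨_, List.mem_cons_self, hQs.trans hsub⟩
          · exact ⟨Q, List.mem_cons_of_mem _ hQ, hQs⟩
      · intro i hi j hj hij
        rcases eq_or_ne i i₀ with rfl | hi'
        · rw [Function.update_self, Function.update_of_ne hij.symm]
          exact hdisj j (Finset.mem_erase.2 ⟨hij.symm, hj⟩)
        · rcases eq_or_ne j i₀ with rfl | hj'
          · rw [Function.update_self, Function.update_of_ne hij]
            exact (hdisj i (Finset.mem_erase.2 ⟨hij, hi⟩)).symm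
          · rw [Function.update_of_ne hi', Function.update_of_ne hj']
            exact hX2 i (Finset.mem_erase.2 ⟨hi', hi⟩) j (Finset.mem_erase.2 ⟨hj', hj⟩) hij
      · intro i hi
        rcases eq_or_ne i i₀ with rfl | hi'
        · rw [Function.update_self, hst i hi₀t]
        · rw [Function.update_of_ne hi']
          exact hX3 i (Finset.mem_erase.2 ⟨hi', hi⟩)
    · -- nobody accepts the first box: discard it
      push Not at hB
      obtain ⟨X, hX1, hX2, hX3⟩ := ih A L (by omega)
        -- A last remaining box cannot be the one discarded: each agent values it at `A.card`
        -- thresholds or more, and `A` is nonempty.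
        (by
          rintro rfl
          obtain ⟨i, hi⟩ := hA
          have h1 := hv i hi
          have h2 := hB i hi
          have h3 : (1 : ℝ) ≤ A.card := by exact_mod_cast Finset.card_pos.2 ⟨i, hi⟩
          simp only [List.length_nil, Nat.cast_zero, List.map_nil, List.sum_nil] at h1
          nlinarith [ht i])
        hd.2
        (by
          intro i hi
          linarith [hv i hi, hB i hi])
      refine ⟨X, fun i hi => ?_, hX2, hX3⟩
      obtain ⟨Q, hQ, hQs⟩ := hX1 i hi
      exact ⟨Q, List.mem_cons_of_mem _ hQ, hQs⟩

/-- A measure with bounded density depends continuously on the position of a vertical cut. -/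
lemma continuousOn_measureReal_halfOpenBox (μ : Measure (ℝ × ℝ)) [IsFiniteMeasure μ] {M : ℝ}
    (hμ : ∀ X, μ X ≤ ENNReal.ofReal M * volume X) (a : ℝ) (J : ℝ × ℝ) :
    ContinuousOn (fun s => μ.real (halfOpenBox ((a, s), J))) (Ici a) := by
  -- A slice is worth at most density bound times height times width, which gives a Lipschitz bound.
  -- The maxima with `0` cover a negative bound `M` and an empty interval `J`.
  have hslice : ∀ s s' : ℝ, s ≤ s' → μ.real (halfOpenBox ((s, s'), J)) ≤
      max M 0 * max (J.2 - J.1) 0 * (s' - s) := by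
    intro s s' hs
    refine ENNReal.toReal_le_of_le_ofReal (by have := sub_nonneg.2 hs; positivity) ((hμ _).trans ?_)
    rw [halfOpenBox, Measure.volume_eq_prod, Measure.prod_prod, Real.volume_Ioc, Real.volume_Ioc]
    simp only
    rw [mul_assoc, ENNReal.ofReal_mul (le_max_right _ _), ENNReal.ofReal_mul (le_max_right _ _),
      mul_comm (ENNReal.ofReal (max (J.2 - J.1) 0))]
    gcongr <;> exact le_max_left _ _
  have hL : LipschitzOnWith (Real.toNNReal (max M 0 * max (J.2 - J.1) 0))
      (fun s => μ.real (halfOpenBox ((a, s), J))) (Ici a) := by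
    apply LipschitzOnWith.of_le_add_mul
    intro s hs s' hs'
    rw [Real.coe_toNNReal _ (by positivity)]
    rcases le_total s s' with h | h
    · refine (measureReal_mono (Set.prod_mono (Ioc_subset_Ioc_right h) Subset.rfl)).trans ?_
      exact le_add_of_nonneg_right (by positivity)
    · rw [measureReal_halfOpenBox_split μ J hs' h]
      refine add_le_add le_rfl ((hslice _ _ h).trans ?_)
      gcongr
      exact le_abs_self _
  exact hL.continuousOn

/-! ### Grids adapted to a rectilinear polygon -/

/-- Induct by removing the minimum of `A`: a sequence starting there is extended by putting `a₀` in
front. After the last prescribed point the sequence goes on in unit steps, so every real above `a₀`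
falls into a cell. -/
lemma exists_breakpoints (A : Finset ℝ) : ∀ a₀ : ℝ, (∀ a ∈ A, a₀ < a) →
    ∃ x : ℕ → ℝ, StrictMono x ∧ x 0 = a₀ ∧ (∀ a ∈ A, a ∈ range x) ∧ Tendsto x atTop atTop := by
  induction A using Finset.induction_on_min with
  | empty =>
    intro a₀ _
    exact ⟨fun n => a₀ + n, fun m n h => by simpa using h, by simp, by simp,
      tendsto_atTop_add_const_left _ _ tendsto_natCast_atTop_atTop⟩
  | insert a s hs ih =>
    intro a₀ ha₀
    obtain ⟨x, hx, hx0, hxs, hxt⟩ := ih a hs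
    have h0 : a₀ < x 0 := hx0 ▸ ha₀ a (Finset.mem_insert_self a s)
    refine ⟨fun n => Nat.casesOn n a₀ x, strictMono_nat_of_lt_succ ?_, rfl, ?_, ?_⟩
    · rintro (_ | n)
      · exact h0
      · exact hx n.lt_succ_self
    · intro b hb
      rcases Finset.mem_insert.1 hb with rfl | hb
      · exact ⟨1, hx0⟩
      · obtain ⟨n, hn⟩ := hxs b hb
        exact ⟨n + 1, hn⟩
    · exact (tendsto_add_atTop_iff_nat 1).1 hxt

/-- The breakpoints `x` and `y` form a grid that contains `C` and whose lines contain its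
frontier. -/
structure IsGridFor (C : Set (ℝ × ℝ)) (x y : ℕ → ℝ) : Prop where
  strictMono_fst : StrictMono x
  strictMono_snd : StrictMono y
  tendsto_fst : Tendsto x atTop atTop
  tendsto_snd : Tendsto y atTop atTop
  lt_fst : ∀ p ∈ C, x 0 < p.1
  lt_snd : ∀ p ∈ C, y 0 < p.2
  frontier_subset : ∀ p ∈ frontier C, p.1 ∈ range x ∨ p.2 ∈ range y

lemma fst_eq_or_snd_eq_of_mem_edgeSet {N : ℕ} {P : Polygon (ℝ × ℝ) N}
    (hP : IsSimpleRectilinearChain P) {i : Fin N} {p : ℝ × ℝ} (hp : p ∈ P.edgeSet ℝ i) :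
    p.1 = (P i).1 ∨ p.2 = (P i).2 := by
  obtain ⟨t, -, rfl⟩ := hp
  rcases hP.perpendicular i with h | h
  · left
    simp [AffineMap.lineMap_apply, h.1]
  · right
    simp [AffineMap.lineMap_apply, h.1]

/-- The breakpoints include all vertex coordinates and start strictly below `C`. Every frontier
point shares a coordinate with a vertex, because edges are axis-parallel. -/
lemma IsRectilinearPolygon.exists_isGridFor {C : Set (ℝ × ℝ)} (hC : IsRectilinearPolygon C) :
    ∃ x y, IsGridFor C x y := by
  obtain ⟨N, P, hP, hfr⟩ := hC.boundary
  have key : ∀ f : ℝ × ℝ → ℝ, Continuous f → ∃ x : ℕ → ℝ, StrictMono x ∧ Tendsto x atTop atTop ∧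
      (∀ p ∈ C, x 0 < f p) ∧ ∀ i, f (P i) ∈ range x := by
    intro f hf
    obtain ⟨b, hb⟩ := (hC.compact.image hf).bddBelow
    obtain ⟨b', hb'⟩ := (Finset.univ.image fun i => f (P i)).bddBelow
    obtain ⟨x, hx, hx0, hxA, hxt⟩ :=
      exists_breakpoints (Finset.univ.image fun i => f (P i)) (min b b' - 1)
        fun a ha => by linarith [hb' ha, min_le_right b b']
    refine ⟨x, hx, hxt, fun p hp => ?_, fun i => hxA _ (Finset.mem_image_of_mem _ (Finset.mem_univ i))⟩
    have : b ≤ f p := hb (mem_image_of_mem f hp)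
    linarith [min_le_left b b']
  obtain ⟨x, hx, hxt, hxC, hxP⟩ := key Prod.fst continuous_fst
  obtain ⟨y, hy, hyt, hyC, hyP⟩ := key Prod.snd continuous_snd
  refine ⟨x, y, hx, hy, hxt, hyt, hxC, hyC, fun p hp => ?_⟩
  rw [hfr] at hp
  obtain ⟨i, hi⟩ := mem_iUnion.1 hp
  rcases fst_eq_or_snd_eq_of_mem_edgeSet hP hi with h | h
  · exact Or.inl (h ▸ hxP i)
  · exact Or.inr (h ▸ hyP i)

/-- The open cell `s` of the grid. -/
def openCell (x y : ℕ → ℝ) (s : ℕ × ℕ) : Set (ℝ × ℝ) :=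
  Ioo (x s.1) (x (s.1 + 1)) ×ˢ Ioo (y s.2) (y (s.2 + 1))

/-- The closed cell `s` of the grid. -/
def closedCell (x y : ℕ → ℝ) (s : ℕ × ℕ) : Set (ℝ × ℝ) :=
  Icc (x s.1) (x (s.1 + 1)) ×ˢ Icc (y s.2) (y (s.2 + 1))

/-- The half-open cell `s` of the grid. -/
def halfOpenCell (x y : ℕ → ℝ) (s : ℕ × ℕ) : Set (ℝ × ℝ) :=
  Ioc (x s.1) (x (s.1 + 1)) ×ˢ Ioc (y s.2) (y (s.2 + 1))

/-- The cells of the grid that are contained in `C`. -/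
def cellsOf (C : Set (ℝ × ℝ)) (x y : ℕ → ℝ) : Set (ℕ × ℕ) :=
  {s | openCell x y s ⊆ C}

lemma StrictMono.notMem_range_of_mem_Ioo {x : ℕ → ℝ} (hx : StrictMono x) {i : ℕ} {u : ℝ}
    (hu : u ∈ Ioo (x i) (x (i + 1))) : u ∉ range x := by
  rintro ⟨k, rfl⟩
  have h1 := hx.lt_iff_lt.1 hu.1
  have h2 := hx.lt_iff_lt.1 hu.2
  omega

lemma StrictMono.le_succ_of_mem_Icc {x : ℕ → ℝ} (hx : StrictMono x) {i k : ℕ} {u : ℝ}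
    (h : u ∈ Icc (x i) (x (i + 1))) (h' : u ∈ Icc (x k) (x (k + 1))) : k ≤ i + 1 :=
  hx.le_iff_le.1 (h'.1.trans h.2)

lemma StrictMono.eq_of_mem_Ioc {x : ℕ → ℝ} (hx : StrictMono x) {i k : ℕ} {u : ℝ}
    (h : u ∈ Ioc (x i) (x (i + 1))) (h' : u ∈ Ioc (x k) (x (k + 1))) : i = k := by
  have h1 := hx.lt_iff_lt.1 (h'.1.trans_le h.2)
  have h2 := hx.lt_iff_lt.1 (h.1.trans_le h'.2)
  omega

lemma exists_mem_Ioc_of_tendsto {x : ℕ → ℝ} (hx : Monotone x) (ht : Tendsto x atTop atTop) {u : ℝ}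
    (hu : x 0 < u) : ∃ i, u ∈ Ioc (x i) (x (i + 1)) := by
  obtain ⟨n, hn⟩ := (ht.eventually_ge_atTop u).exists
  have h : u ∈ Ioc (x 0) (x n) := ⟨hu, hn⟩
  rw [← hx.biUnion_Ico_Ioc_map_succ 0 n] at h
  simp only [mem_iUnion] at h
  obtain ⟨i, -, hi⟩ := h
  exact ⟨i, hi⟩

namespace IsGridFor

variable {C : Set (ℝ × ℝ)} {x y : ℕ → ℝ}

lemma closure_openCell (h : IsGridFor C x y) (s : ℕ × ℕ) :
    closure (openCell x y s) = closedCell x y s := by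
  rw [openCell, closure_prod_eq, closure_Ioo (h.strictMono_fst s.1.lt_succ_self).ne,
    closure_Ioo (h.strictMono_snd s.2.lt_succ_self).ne, closedCell]

lemma isOpen_openCell (s : ℕ × ℕ) : IsOpen (openCell x y s) := isOpen_Ioo.prod isOpen_Ioo

lemma isClosed_closedCell (s : ℕ × ℕ) : IsClosed (closedCell x y s) := isClosed_Icc.prod isClosed_Icc

lemma openCell_nonempty (h : IsGridFor C x y) (s : ℕ × ℕ) : (openCell x y s).Nonempty :=
  (nonempty_Ioo.2 (h.strictMono_fst s.1.lt_succ_self)).prod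
    (nonempty_Ioo.2 (h.strictMono_snd s.2.lt_succ_self))

/-- An open cell is connected and misses the frontier, so it lies entirely in the interior or
entirely in the exterior. -/
lemma mem_cellsOf_of_nonempty_inter (h : IsGridFor C x y) {s : ℕ × ℕ}
    (hs : (openCell x y s ∩ C).Nonempty) : s ∈ cellsOf C x y := by
  have hd : Disjoint (openCell x y s) (frontier C) := by
    rw [disjoint_left]
    intro p hp hf
    rcases h.frontier_subset p hf with h' | h'
    · exact h.strictMono_fst.notMem_range_of_mem_Ioo hp.1 h'
    · exact h.strictMono_snd.notMem_range_of_mem_Ioo hp.2 h'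
  have hpre : IsPreconnected (openCell x y s) := isPreconnected_Ioo.prod isPreconnected_Ioo
  have hcov : openCell x y s ⊆ interior C ∪ (closure C)ᶜ := by
    intro p hp
    by_contra hn
    rw [mem_union, not_or, notMem_compl_iff] at hn
    exact disjoint_left.1 hd hp ⟨hn.2, hn.1⟩
  have hdis : Disjoint (interior C) (closure C)ᶜ :=
    disjoint_compl_right.mono_left interior_subset_closure
  obtain ⟨p, hp, hpC⟩ := hs
  refine (hpre.subset_left_of_subset_union isOpen_interior isClosed_closure.isOpen_compl hdis hcov
    ⟨p, hp, ?_⟩).trans interior_subset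
  exact (hcov hp).resolve_right fun hn => hn (subset_closure hpC)

lemma closedCell_subset (h : IsGridFor C x y) (hC : IsClosed C) {s : ℕ × ℕ}
    (hs : s ∈ cellsOf C x y) : closedCell x y s ⊆ C := by
  rw [← h.closure_openCell]
  exact closure_minimal hs hC

lemma mem_cellsOf_of_mem_interior (h : IsGridFor C x y) {s : ℕ × ℕ} {p : ℝ × ℝ}
    (hp : p ∈ interior C) (hps : p ∈ closedCell x y s) : s ∈ cellsOf C x y := by
  rw [← h.closure_openCell] at hps
  obtain ⟨q, hq, hqs⟩ := mem_closure_iff.1 hps _ isOpen_interior hp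
  exact h.mem_cellsOf_of_nonempty_inter ⟨q, hqs, interior_subset hq⟩

lemma exists_mem_halfOpenCell (h : IsGridFor C x y) {p : ℝ × ℝ} (hp : p ∈ C) :
    ∃ s, p ∈ halfOpenCell x y s := by
  obtain ⟨i, hi⟩ := exists_mem_Ioc_of_tendsto h.strictMono_fst.monotone h.tendsto_fst (h.lt_fst p hp)
  obtain ⟨j, hj⟩ := exists_mem_Ioc_of_tendsto h.strictMono_snd.monotone h.tendsto_snd (h.lt_snd p hp)
  exact ⟨(i, j), hi, hj⟩

lemma halfOpenCell_subset_closedCell (s : ℕ × ℕ) : halfOpenCell x y s ⊆ closedCell x y s :=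
  Set.prod_mono Ioc_subset_Icc_self Ioc_subset_Icc_self

lemma openCell_subset_closedCell (s : ℕ × ℕ) : openCell x y s ⊆ closedCell x y s :=
  Set.prod_mono Ioo_subset_Icc_self Ioo_subset_Icc_self

lemma finite_cellsOf (h : IsGridFor C x y) (hC : IsCompact C) : (cellsOf C x y).Finite := by
  obtain ⟨b, hb⟩ := (hC.image continuous_fst).bddAbove
  obtain ⟨b', hb'⟩ := (hC.image continuous_snd).bddAbove
  obtain ⟨m, hm⟩ := (h.tendsto_fst.eventually_ge_atTop b).exists
  obtain ⟨n, hn⟩ := (h.tendsto_snd.eventually_ge_atTop b').exists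
  refine ((finite_Iio m).prod (finite_Iio n)).subset fun s hs => ?_
  obtain ⟨p, hp⟩ := h.openCell_nonempty s
  have h1 : p.1 ≤ b := hb (mem_image_of_mem _ (hs hp))
  have h2 : p.2 ≤ b' := hb' (mem_image_of_mem _ (hs hp))
  exact ⟨h.strictMono_fst.lt_iff_lt.1 (hp.1.1.trans_le (h1.trans hm)),
    h.strictMono_snd.lt_iff_lt.1 (hp.2.1.trans_le (h2.trans hn))⟩

lemma nonempty_cellsOf (h : IsGridFor C x y) (hC : (interior C).Nonempty) :
    (cellsOf C x y).Nonempty := by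
  obtain ⟨p, hp⟩ := hC
  obtain ⟨s, hs⟩ := h.exists_mem_halfOpenCell (interior_subset hp)
  exact ⟨s, h.mem_cellsOf_of_mem_interior hp (halfOpenCell_subset_closedCell s hs)⟩

/-- If `K` separated the cells, the closed cells inside and outside `K` would cover the interior by
two closed sets. By connectedness these meet at an interior point. All cells touching that point
belong to `C`, and they are linked to each other through shared sides. -/
lemma cellConnected_cellsOf (h : IsGridFor C x y) (hC : IsCompact C)
    (hconn : IsPreconnected (interior C)) : CellConnected (cellsOf C x y) := by
  intro K hK hK1 hK2
  set S := cellsOf C x y with hS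
  by_contra hnot
  obtain ⟨t₀, ht₀, ht₀K⟩ := not_subset.1 hnot
  have hfin := h.finite_cellsOf hC
  have hint : ∀ s ∈ S, (interior C ∩ closedCell x y s).Nonempty := by
    intro s hs
    obtain ⟨p, hp⟩ := h.openCell_nonempty s
    exact ⟨p, interior_maximal hs (isOpen_openCell s) hp, openCell_subset_closedCell s hp⟩
  obtain ⟨p, hp, hp1, hp2⟩ := isPreconnected_closed_iff.1 hconn
    (⋃ s ∈ S ∩ K, closedCell x y s) (⋃ s ∈ S \ K, closedCell x y s)
    ((hfin.subset inter_subset_left).isClosed_biUnion fun s _ => isClosed_closedCell s)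
    ((hfin.subset sdiff_subset).isClosed_biUnion fun s _ => isClosed_closedCell s)
    (by
      intro p hp
      obtain ⟨s, hs⟩ := h.exists_mem_halfOpenCell (interior_subset hp)
      have hs' := halfOpenCell_subset_closedCell s hs
      have hsS := h.mem_cellsOf_of_mem_interior hp hs'
      by_cases hsK : s ∈ K
      · exact Or.inl (mem_biUnion ⟨hsS, hsK⟩ hs')
      · exact Or.inr (mem_biUnion ⟨hsS, hsK⟩ hs'))
    (by
      obtain ⟨s, hs⟩ := hK
      exact (hint s hs.1).mono
        (inter_subset_inter_right _ (subset_biUnion_of_mem (u := fun s => closedCell x y s) hs)))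
    ((hint t₀ ht₀).mono (inter_subset_inter_right _
      (subset_biUnion_of_mem (u := fun s => closedCell x y s) ⟨ht₀, ht₀K⟩)))
  simp only [mem_iUnion] at hp1 hp2
  obtain ⟨⟨i, j⟩, ⟨hsS, hsK⟩, hs⟩ := hp1
  obtain ⟨⟨k, l⟩, ⟨htS, htK⟩, ht⟩ := hp2
  -- This cell, in the column of one cell and the row of the other, also touches `p` and bridges a
  -- diagonal contact.
  have hm : (k, j) ∈ S := h.mem_cellsOf_of_mem_interior hp ⟨ht.1, hs.2⟩
  have a1 := h.strictMono_fst.le_succ_of_mem_Icc hs.1 ht.1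
  have a2 := h.strictMono_fst.le_succ_of_mem_Icc ht.1 hs.1
  have b1 := h.strictMono_snd.le_succ_of_mem_Icc hs.2 ht.2
  have b2 := h.strictMono_snd.le_succ_of_mem_Icc ht.2 hs.2
  simp only at a1 a2 b1 b2
  have hmK : (k, j) ∈ K := by
    have : k = i ∨ k = i + 1 ∨ i = k + 1 := by omega
    rcases this with rfl | rfl | rfl
    · exact hsK
    · exact (hK1 i j hsS hm).1 hsK
    · exact (hK1 k j hm hsS).2 hsK
  have : l = j ∨ l = j + 1 ∨ j = l + 1 := by omega
  rcases this with rfl | rfl | rfl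
  · exact htK hmK
  · exact htK ((hK2 k j hm htS).1 hmK)
  · exact htK ((hK2 k l htS hm).2 hmK)

/-- Around the common corner of the block, the three closed cells of `C` fill everything except the
open quadrant occupied by the missing cell. -/
lemma mem_reflexVertices (h : IsGridFor C x y) (hC : IsClosed C) {c : ℕ × ℕ}
    (hc : c ∈ reflexBlocks (cellsOf C x y)) : (x (c.1 + 1), y (c.2 + 1)) ∈ reflexVertices C := by
  obtain ⟨i, j⟩ := c
  have hN : Ioo (x i) (x (i + 2)) ×ˢ Ioo (y j) (y (j + 2)) ∈ 𝓝 (x (i + 1), y (j + 1)) :=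
    prod_mem_nhds
      (Ioo_mem_nhds (h.strictMono_fst (by omega)) (h.strictMono_fst (by omega)))
      (Ioo_mem_nhds (h.strictMono_snd (by omega)) (h.strictMono_snd (by omega)))
  have hin : ∀ s ∈ cellsOf C x y, ∀ q ∈ closedCell x y s, q ∈ C :=
    fun s hs q hq => h.closedCell_subset hC hs hq
  have hout : ∀ s ∉ cellsOf C x y, ∀ q ∈ openCell x y s, q ∉ C :=
    fun s hs q hq hqC => hs (h.mem_cellsOf_of_nonempty_inter ⟨q, hq, hqC⟩)
  have ll := hin (i, j)
  have lr := hin (i + 1, j)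
  have ul := hin (i, j + 1)
  have ur := hin (i + 1, j + 1)
  have ll' := hout (i, j)
  have lr' := hout (i + 1, j)
  have ul' := hout (i, j + 1)
  have ur' := hout (i + 1, j + 1)
  simp only [closedCell, openCell, mem_prod, mem_Icc, mem_Ioo, add_assoc, Nat.reduceAdd,
    Prod.forall] at ll lr ul ur ll' lr' ul' ur'
  rcases hc with ⟨⟨h1, h2⟩, ⟨h3, h4⟩ | ⟨h3, h4⟩⟩ | ⟨⟨h1, h2⟩, ⟨h3, h4⟩ | ⟨h3, h4⟩⟩
  · refine ⟨-1, -1, by simp, by simp, ?_⟩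
    filter_upwards [hN] with ⟨u, v⟩ ⟨⟨hu1, hu2⟩, hv1, hv2⟩
    simp only at *
    specialize ll h1 u v
    specialize ul h2 u v
    specialize lr h3 u v
    specialize ur' h4 u v
    grind
  · refine ⟨-1, 1, by simp, by simp, ?_⟩
    filter_upwards [hN] with ⟨u, v⟩ ⟨⟨hu1, hu2⟩, hv1, hv2⟩
    simp only at *
    specialize ll h1 u v
    specialize ul h2 u v
    specialize ur h3 u v
    specialize lr' h4 u v
    grind
  · refine ⟨1, -1, by simp, by simp, ?_⟩
    filter_upwards [hN] with ⟨u, v⟩ ⟨⟨hu1, hu2⟩, hv1, hv2⟩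
    simp only at *
    specialize lr h1 u v
    specialize ur h2 u v
    specialize ll h3 u v
    specialize ul' h4 u v
    grind
  · refine ⟨1, 1, by simp, by simp, ?_⟩
    filter_upwards [hN] with ⟨u, v⟩ ⟨⟨hu1, hu2⟩, hv1, hv2⟩
    simp only at *
    specialize lr h1 u v
    specialize ur h2 u v
    specialize ul h3 u v
    specialize ll' h4 u v
    grind

lemma encard_reflexBlocks_le (h : IsGridFor C x y) (hC : IsClosed C) :
    (reflexBlocks (cellsOf C x y)).encard ≤ (reflexVertices C).encard := by
  have hinj : Function.Injective fun c : ℕ × ℕ => (x (c.1 + 1), y (c.2 + 1)) := by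
    intro c c' hcc
    have h1 := h.strictMono_fst.injective (Prod.ext_iff.1 hcc).1
    have h2 := h.strictMono_snd.injective (Prod.ext_iff.1 hcc).2
    exact Prod.ext (by omega) (by omega)
  rw [← hinj.encard_image]
  refine encard_le_encard ?_
  rintro _ ⟨c, hc, rfl⟩
  exact h.mem_reflexVertices hC hc

end IsGridFor

/-! ### Partition of the polygon into boxes -/

lemma Set.OrdConnected.eq_Ico_of_nat {I : Set ℕ} (hI : I.OrdConnected) (hne : I.Nonempty)
    (hb : BddAbove I) : I = Ico (sInf I) (sSup I + 1) := by
  ext k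
  refine ⟨fun hk => ⟨Nat.sInf_le hk, Nat.lt_succ_of_le (le_csSup hb hk)⟩, fun hk => ?_⟩
  exact hI.out (Nat.sInf_mem hne) (Nat.sSup_mem hne hb) ⟨hk.1, Nat.le_of_lt_succ hk.2⟩

/-- The half-open box made up by the cells of the grid in the columns `P.1` and the rows `P.2`. -/
noncomputable def pieceBox (x y : ℕ → ℝ) (P : Set ℕ × Set ℕ) : (ℝ × ℝ) × (ℝ × ℝ) :=
  ((x (sInf P.1), x (sSup P.1 + 1)), (y (sInf P.2), y (sSup P.2 + 1)))

/-- Half-open intervals between consecutive breakpoints glue together without gap or overlap; this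
is why the boxes are half-open. -/
lemma mem_halfOpenBox_pieceBox {x y : ℕ → ℝ} (hx : Monotone x) (hy : Monotone y)
    {P : Set ℕ × Set ℕ} (h1 : P.1.OrdConnected) (h2 : P.2.OrdConnected) (hne : (P.1 ×ˢ P.2).Nonempty)
    (hf : (P.1 ×ˢ P.2).Finite) {q : ℝ × ℝ} :
    q ∈ halfOpenBox (pieceBox x y P) ↔ ∃ s ∈ P.1 ×ˢ P.2, q ∈ halfOpenCell x y s := by
  obtain ⟨hne1, hne2⟩ := prod_nonempty_iff.1 hne
  have e1 := h1.eq_Ico_of_nat hne1 (hf.of_prod_left hne2).bddAbove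
  have e2 := h2.eq_Ico_of_nat hne2 (hf.of_prod_right hne1).bddAbove
  rw [halfOpenBox, pieceBox]
  simp only
  rw [← hx.biUnion_Ico_Ioc_map_succ, ← hy.biUnion_Ico_Ioc_map_succ, ← e1, ← e2]
  simp only [mem_prod, mem_iUnion, halfOpenCell, exists_prop, Prod.exists, Nat.succ_eq_succ]
  constructor
  · rintro ⟨⟨i, hi, hi'⟩, j, hj, hj'⟩
    exact ⟨i, j, ⟨hi, hj⟩, hi', hj'⟩
  · rintro ⟨i, j, ⟨hi, hj⟩, hi', hj'⟩
    exact ⟨⟨i, hi, hi'⟩, j, hj, hj'⟩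

/-- A rectilinear polygon with `R` reflex vertices is, up to a null set, the disjoint union of at
most `R + 1` rectangles. -/
theorem IsRectilinearPolygon.exists_box_partition {C : Set (ℝ × ℝ)} (hC : IsRectilinearPolygon C)
    {R : ℕ} (hR : (reflexVertices C).encard = R) :
    ∃ L : List ((ℝ × ℝ) × (ℝ × ℝ)), L ≠ [] ∧ L.length ≤ R + 1 ∧
      L.Pairwise (fun P Q => Disjoint (halfOpenBox P) (halfOpenBox Q)) ∧
      (∀ Q ∈ L, halfOpenBox Q ⊆ C) ∧ volume (C \ ⋃ Q ∈ L, halfOpenBox Q) = 0 := by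
  obtain ⟨x, y, h⟩ := hC.exists_isGridFor
  have hcl := hC.compact.isClosed
  set S := cellsOf C x y with hS
  have hfin : S.Finite := h.finite_cellsOf hC.compact
  have hSne : S.Nonempty := h.nonempty_cellsOf hC.connected.nonempty
  have hle : (reflexBlocks S).encard ≤ R := hR ▸ h.encard_reflexBlocks_le hcl
  have hrfin : (reflexBlocks S).Finite := finite_of_encard_le_coe hle
  have hrcard : (reflexBlocks S).ncard ≤ R := by
    rw [← hrfin.cast_ncard_eq] at hle
    exact_mod_cast hle
  have hpfin : (cellPiece S '' S).Finite := hfin.image _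
  have hpcard := ncard_cellPiece_le hSne (h.cellConnected_cellsOf hC.compact hC.connected.2) hrfin
  have hmem : ∀ s ∈ S, ∀ q, q ∈ halfOpenBox (pieceBox x y (cellPiece S s)) ↔
      ∃ t ∈ (cellPiece S s).1 ×ˢ (cellPiece S s).2, q ∈ halfOpenCell x y t := by
    intro s hs q
    refine mem_halfOpenBox_pieceBox h.strictMono_fst.monotone h.strictMono_snd.monotone
      (by rw [cellPiece, cellRun]; infer_instance) (by rw [cellPiece, rowRun]; infer_instance)
      ⟨s, mem_prod_cellPiece hs⟩ (hfin.subset fun t ht => (mem_of_mem_prod_cellPiece ht).1)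
  have hLmem : ∀ P, P ∈ hpfin.toFinset.toList ↔ P ∈ cellPiece S '' S := by simp
  refine ⟨hpfin.toFinset.toList.map (pieceBox x y), ?_, ?_, ?_, ?_, ?_⟩
  · obtain ⟨s, hs⟩ := hSne
    exact List.ne_nil_of_mem (List.mem_map_of_mem ((hLmem _).2 (mem_image_of_mem _ hs)))
  · rw [List.length_map, Finset.length_toList, ← ncard_eq_toFinset_card _ hpfin]
    omega
  · rw [List.pairwise_map]
    refine (Finset.nodup_toList _).imp_of_mem ?_
    intro P Q hP hQ hPQ
    obtain ⟨s, hs, rfl⟩ := (hLmem P).1 hP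
    obtain ⟨t, ht, rfl⟩ := (hLmem Q).1 hQ
    rw [disjoint_left]
    intro q hq hq'
    obtain ⟨a, ha, hqa⟩ := (hmem s hs q).1 hq
    obtain ⟨b, hb, hqb⟩ := (hmem t ht q).1 hq'
    have hab : a = b := Prod.ext (h.strictMono_fst.eq_of_mem_Ioc hqa.1 hqb.1)
      (h.strictMono_snd.eq_of_mem_Ioc hqa.2 hqb.2)
    subst hab
    exact hPQ ((mem_of_mem_prod_cellPiece ha).2.symm.trans (mem_of_mem_prod_cellPiece hb).2)
  · intro Q hQ
    obtain ⟨P, hP, rfl⟩ := List.mem_map.1 hQ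
    obtain ⟨s, hs, rfl⟩ := (hLmem P).1 hP
    intro q hq
    obtain ⟨a, ha, hqa⟩ := (hmem s hs q).1 hq
    exact h.closedCell_subset hcl (mem_of_mem_prod_cellPiece ha).1
      (IsGridFor.halfOpenCell_subset_closedCell a hqa)
  -- Only points on grid lines can be missed, and countably many lines form a null set.
  · have hnull : volume (range x ×ˢ (univ : Set ℝ) ∪ (univ : Set ℝ) ×ˢ range y) = 0 := by
      rw [measure_union_null_iff, Measure.volume_eq_prod, Measure.prod_prod, Measure.prod_prod,
        (countable_range x).measure_zero, (countable_range y).measure_zero]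
      simp
    refine measure_mono_null ?_ hnull
    rintro q ⟨hqC, hq⟩
    by_contra hn
    simp only [mem_union, mem_prod, mem_univ, and_true, true_and, not_or] at hn
    obtain ⟨s, hs⟩ := h.exists_mem_halfOpenCell hqC
    have hs' : q ∈ openCell x y s :=
      ⟨⟨hs.1.1, lt_of_le_of_ne hs.1.2 fun e => hn.1 ⟨_, e.symm⟩⟩,
        ⟨hs.2.1, lt_of_le_of_ne hs.2.2 fun e => hn.2 ⟨_, e.symm⟩⟩⟩
    have hsS : s ∈ S := h.mem_cellsOf_of_nonempty_inter ⟨q, hs', hqC⟩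
    refine hq (mem_biUnion (x := pieceBox x y (cellPiece S s)) ?_ ?_)
    · exact List.mem_map_of_mem ((hLmem _).2 (mem_image_of_mem _ hsS))
    · exact (hmem s hsS q).2 ⟨s, mem_prod_cellPiece hsS, hs⟩

/-! ### Value-densities as measures and the guaranteed fraction -/

lemma measureReal_iUnion_halfOpenBox (μ : Measure (ℝ × ℝ)) [IsFiniteMeasure μ]
    (L : List ((ℝ × ℝ) × (ℝ × ℝ)))
    (hL : L.Pairwise (fun P Q => Disjoint (halfOpenBox P) (halfOpenBox Q))) :
    μ.real (⋃ Q ∈ L, halfOpenBox Q) = (L.map fun Q => μ.real (halfOpenBox Q)).sum := by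
  induction L with
  | nil => simp
  | cons P L ih =>
    rw [List.pairwise_cons] at hL
    have e : (⋃ Q ∈ P :: L, halfOpenBox Q) = halfOpenBox P ∪ ⋃ Q ∈ L, halfOpenBox Q := by
      ext q
      simp
    have hm : MeasurableSet (⋃ Q ∈ L, halfOpenBox Q) :=
      L.finite_toSet.measurableSet_biUnion fun Q _ => measurableSet_halfOpenBox Q
    rw [e, measureReal_union (disjoint_iUnion₂_right.2 hL.1) hm (measure_ne_top _ _)
      (measure_ne_top _ _), List.map_cons, List.sum_cons, ih hL.2]

/-- The measure on `C` with density `v`. -/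
noncomputable def densityMeasure (C : Set (ℝ × ℝ)) (v : ℝ × ℝ → ℝ) : Measure (ℝ × ℝ) :=
  (volume.restrict C).withDensity fun q => ENNReal.ofReal (v q)

namespace IsValueDensity

variable {C : Set (ℝ × ℝ)} {v : ℝ × ℝ → ℝ}

lemma isFiniteMeasure (h : IsValueDensity C v) : IsFiniteMeasure (densityMeasure C v) :=
  isFiniteMeasure_withDensity_ofReal h.integrable.2

lemma exists_densityMeasure_le (h : IsValueDensity C v) (hC : MeasurableSet C) :
    ∃ M : ℝ, ∀ X, densityMeasure C v X ≤ ENNReal.ofReal M * volume X := by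
  obtain ⟨M, hM⟩ := h.bounded
  refine ⟨M, fun X => ?_⟩
  have h1 : densityMeasure C v ≤ (volume.restrict C).withDensity fun _ => ENNReal.ofReal M := by
    refine withDensity_mono ?_
    filter_upwards [ae_restrict_mem hC] with q hq
    exact ENNReal.ofReal_le_ofReal (hM q hq)
  refine (h1 X).trans ?_
  rw [withDensity_const, Measure.smul_apply, smul_eq_mul]
  gcongr
  exact Measure.restrict_le_self

lemma measureReal_eq (h : IsValueDensity C v) {X : Set (ℝ × ℝ)} (hX : MeasurableSet X)
    (hXC : X ⊆ C) : (densityMeasure C v).real X = pieceValue v X := by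
  have hnn : 0 ≤ᵐ[volume.restrict X] v := by
    filter_upwards [ae_restrict_mem hX] with q hq using h.nonneg q (hXC hq)
  rw [pieceValue, integral_eq_lintegral_of_nonneg_ae hnn (h.integrable.mono_set hXC).1,
    Measure.real, densityMeasure, withDensity_apply _ hX, Measure.restrict_restrict hX,
    inter_eq_left.2 hXC]

end IsValueDensity

lemma isRectangle_halfOpenBox {Q : (ℝ × ℝ) × (ℝ × ℝ)} (h : (halfOpenBox Q).Nonempty) :
    IsRectangle (halfOpenBox Q) := by
  have key : ∀ a b : ℝ, (Ioc a b).Nonempty → (Ioc a b).Nontrivial := by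
    intro a b hab
    have := nonempty_Ioc.1 hab
    exact ⟨(a + b) / 2, ⟨by linarith, by linarith⟩, b, ⟨this, le_rfl⟩, by linarith⟩
  obtain ⟨h1, h2⟩ := prod_nonempty_iff.1 h
  exact ⟨_, _, ordConnected_Ioc, ordConnected_Ioc, key _ _ h1, key _ _ h2, rfl⟩

/-- The knife argument needs positive thresholds. An agent who values `C` at zero is satisfied by
any piece, so its density may be replaced by the constant `1`. -/
lemma IsRectilinearPolygon.exists_pos_density {C : Set (ℝ × ℝ)} (hC : IsRectilinearPolygon C)
    {v : ℝ × ℝ → ℝ} (hv : IsValueDensity C v) :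
    ∃ u, IsValueDensity C u ∧ 0 < pieceValue u C ∧ (0 < pieceValue v C → u = v) := by
  rcases lt_or_ge 0 (pieceValue v C) with h | h
  · exact ⟨v, hv, h, fun _ => rfl⟩
  · have hfin : volume C < ⊤ := hC.compact.measure_lt_top
    refine ⟨fun _ => 1, ⟨?_, fun _ _ => zero_le_one, 1, fun _ _ => le_rfl⟩, ?_,
      fun h' => absurd h' h.not_gt⟩
    · exact integrableOn_const hfin.ne
    · have hpos : 0 < volume C :=
        (isOpen_interior.measure_pos volume hC.connected.nonempty).trans_le
          (measure_mono interior_subset)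
      simpa [pieceValue, Measure.real] using ENNReal.toReal_pos hpos.ne' hfin.ne

/-- In a rectilinear polygon with `R` reflex vertices, the fraction `1 / (n + R)` can be guaranteed
to each of `n` agents. -/
theorem canGuarantee_one_div (n : ℕ) (hn : 1 ≤ n) (R : ℕ) :
    CanGuarantee n R (1 / ((n : ℝ) + (R : ℝ))) := by
  intro C hC hR v hv
  obtain ⟨L, hL, hLlen, hLd, hLC, hLnull⟩ := hC.exists_box_partition hR
  have hCm : MeasurableSet C := hC.compact.measurableSet
  choose u hu hupos huv using fun i => hC.exists_pos_density (hv i)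
  let μ : Fin n → Measure (ℝ × ℝ) := fun i => densityMeasure C (u i)
  have : ∀ i, IsFiniteMeasure (μ i) := fun i => (hu i).isFiniteMeasure
  have hnR : 0 < (n : ℝ) + (R : ℝ) := by positivity
  let t : Fin n → ℝ := fun i => 1 / ((n : ℝ) + (R : ℝ)) * pieceValue (u i) C
  have ht : ∀ i, 0 < t i := fun i => mul_pos (one_div_pos.2 hnR) (hupos i)
  -- There are at most `R + 1` boxes, so the required number of thresholds is at most `n + R`.
  have hsum : ∀ i, t i * (Finset.univ.card (α := Fin n) + L.length - 1) ≤
      (L.map fun Q => (μ i).real (halfOpenBox Q)).sum := by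
    intro i
    have h1 : pieceValue (u i) C ≤ (L.map fun Q => (μ i).real (halfOpenBox Q)).sum := by
      rw [← measureReal_iUnion_halfOpenBox (μ i) L hLd, ← (hu i).measureReal_eq hCm Subset.rfl]
      obtain ⟨M, hM⟩ := (hu i).exists_densityMeasure_le hCm
      have h0 : μ i (C \ ⋃ Q ∈ L, halfOpenBox Q) = 0 :=
        le_antisymm ((hM _).trans (by rw [hLnull, mul_zero])) bot_le
      refine ENNReal.toReal_mono (measure_ne_top _ _) ?_
      calc μ i C ≤ μ i ((⋃ Q ∈ L, halfOpenBox Q) ∪ (C \ ⋃ Q ∈ L, halfOpenBox Q)) :=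
            measure_mono (by rw [union_sdiff_self]; exact subset_union_right)
        _ ≤ _ := measure_union_le _ _
        _ = _ := by rw [h0, add_zero]
    refine le_trans ?_ h1
    have h2 : (L.length : ℝ) ≤ R + 1 := by exact_mod_cast hLlen
    have h3 : t i * ((n : ℝ) + R) = pieceValue (u i) C := by
      simp only [t]
      field_simp
    rw [← h3, Finset.card_univ, Fintype.card_fin]
    exact mul_le_mul_of_nonneg_left (by linarith) (ht i).le
  obtain ⟨X, hX1, hX2, hX3⟩ := exists_boxes_of_list μ
    (fun i a J => by
      obtain ⟨M, hM⟩ := (hu i).exists_densityMeasure_le hCm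
      exact continuousOn_measureReal_halfOpenBox (μ i) hM a J)
    t ht _ Finset.univ L le_rfl hL hLd fun i _ => hsum i
  have hXC : ∀ i, halfOpenBox (X i) ⊆ C := by
    intro i
    obtain ⟨Q, hQ, hXQ⟩ := hX1 i (Finset.mem_univ i)
    exact hXQ.trans (hLC Q hQ)
  refine ⟨fun i => halfOpenBox (X i), ⟨fun i => isRectangle_halfOpenBox ?_, hXC, fun i j =>
    hX2 i (Finset.mem_univ i) j (Finset.mem_univ j)⟩, fun i => ?_⟩
  -- A box of positive value is nonempty, hence has sides of positive length.
  · rw [nonempty_iff_ne_empty]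
    intro he
    have := (ht i).trans_le (hX3 i (Finset.mem_univ i))
    simp [he] at this
  · rcases lt_or_ge 0 (pieceValue (v i) C) with h | h
    · have := hX3 i (Finset.mem_univ i)
      rw [(hu i).measureReal_eq (measurableSet_halfOpenBox _) (hXC i)] at this
      simpa only [t, huv i h] using this
    · refine (mul_nonpos_of_nonneg_of_nonpos (one_div_pos.2 hnR).le h).trans ?_
      exact setIntegral_nonneg (measurableSet_halfOpenBox _) fun q hq => (hv i).nonneg q (hXC i hq)

/-! ### The staircase is a rectilinear polygon -/

section Staircase

variable {R : ℕ} {p : ℝ × ℝ}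

lemma mem_staircase : p ∈ staircase R ↔
    ∃ k ≤ R, 0 ≤ p.1 ∧ p.1 ≤ (k : ℝ) + 1 ∧ 0 ≤ p.2 ∧ p.2 ≤ (R : ℝ) + 1 - k := by
  simp only [staircase, mem_iUnion, mem_prod, mem_Icc, Finset.mem_range, Nat.lt_succ_iff,
    exists_prop, and_assoc]

/-- The union of stairs is rewritten as the big square with the open quadrants at the inner corners
removed, a form suited to computing closures and interiors. -/
lemma mem_staircase_iff_forall : p ∈ staircase R ↔ 0 ≤ p.1 ∧ 0 ≤ p.2 ∧ p.1 ≤ R + 1 ∧ p.2 ≤ R + 1 ∧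
    ∀ k : ℕ, 1 ≤ k → k ≤ R → p.1 ≤ k ∨ p.2 ≤ (R : ℝ) + 1 - k := by
  rw [mem_staircase]
  constructor
  · rintro ⟨k, hk, h1, h2, h3, h4⟩
    have hk' : (k : ℝ) ≤ R := by exact_mod_cast hk
    have hk0 : (0 : ℝ) ≤ k := k.cast_nonneg
    refine ⟨h1, h3, by linarith, by linarith, fun l _ _ => ?_⟩
    rcases Nat.lt_or_ge k l with h | h
    · left
      have : (k : ℝ) + 1 ≤ l := by exact_mod_cast h
      linarith
    · right
      have : (l : ℝ) ≤ k := by exact_mod_cast h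
      linarith
  · rintro ⟨h1, h2, h3, h4, h5⟩
    have hc := Nat.le_ceil p.1
    -- The stair is chosen so that `k < p.1 ≤ k + 1`; ceiling zero is sent to stair `0`.
    obtain hz | ⟨k, hk⟩ : ⌈p.1⌉₊ = 0 ∨ ∃ k, ⌈p.1⌉₊ = k + 1 :=
      (Nat.eq_zero_or_pos _).imp_right fun h => ⟨_, (Nat.succ_pred_eq_of_pos h).symm⟩
    · rw [hz] at hc
      exact ⟨0, Nat.zero_le _, h1, by push_cast at hc ⊢; linarith, h2, by push_cast; linarith⟩
    · have hlt : (k : ℝ) < p.1 := Nat.lt_ceil.1 (by omega)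
      have hkR : k ≤ R := by
        have : (k : ℝ) < R + 1 := hlt.trans_le h3
        exact Nat.lt_succ_iff.1 (by exact_mod_cast this)
      rw [hk] at hc
      refine ⟨k, hkR, h1, by exact_mod_cast hc, h2, ?_⟩
      rcases Nat.eq_zero_or_pos k with rfl | hk0
      · push_cast; linarith
      · exact (h5 k hk0 hkR).resolve_left hlt.not_ge

lemma isCompact_staircase (R : ℕ) : IsCompact (staircase R) :=
  (Finset.range (R + 1)).isCompact_biUnion fun _ _ => isCompact_Icc.prod isCompact_Icc

lemma compl_staircase (R : ℕ) : (staircase R)ᶜ = Iio 0 ×ˢ univ ∪ univ ×ˢ Iio 0 ∪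
    Ioi ((R : ℝ) + 1) ×ˢ univ ∪ univ ×ˢ Ioi ((R : ℝ) + 1) ∪
    ⋃ k ∈ Finset.Icc 1 R, Ioi (k : ℝ) ×ˢ Ioi ((R : ℝ) + 1 - k) := by
  ext p
  simp only [mem_compl_iff, mem_staircase_iff_forall, mem_union, mem_prod, mem_Iio, mem_univ,
    and_true, true_and, mem_Ioi, mem_iUnion, Finset.mem_Icc, exists_prop]
  push Not
  grind

lemma mem_frontier_staircase : p ∈ frontier (staircase R) ↔ p ∈ staircase R ∧
    (p.1 ≤ 0 ∨ p.2 ≤ 0 ∨ (R : ℝ) + 1 ≤ p.1 ∨ (R : ℝ) + 1 ≤ p.2 ∨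
      ∃ k : ℕ, 1 ≤ k ∧ k ≤ R ∧ (k : ℝ) ≤ p.1 ∧ (R : ℝ) + 1 - k ≤ p.2) := by
  rw [frontier_eq_closure_inter_closure, (isCompact_staircase R).isClosed.closure_eq,
    compl_staircase, closure_union, Finset.closure_biUnion]
  simp only [closure_union, closure_prod_eq, closure_Iio, closure_Ioi,
    closure_univ, mem_inter_iff, mem_union, mem_prod, mem_Iic, mem_Ici, mem_univ, and_true,
    true_and, mem_iUnion, Finset.mem_Icc, exists_prop, or_assoc, and_assoc]

lemma mem_interior_staircase : p ∈ interior (staircase R) ↔ 0 < p.1 ∧ 0 < p.2 ∧ p.1 < R + 1 ∧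
    p.2 < R + 1 ∧ ∀ k : ℕ, 1 ≤ k → k ≤ R → p.1 < k ∨ p.2 < (R : ℝ) + 1 - k := by
  have h : p ∈ interior (staircase R) ↔ p ∈ staircase R ∧ p ∉ frontier (staircase R) := by
    rw [← self_sdiff_frontier, Set.mem_sdiff]
  rw [h, mem_frontier_staircase, mem_staircase_iff_forall]
  constructor
  · rintro ⟨h1, h2⟩
    push Not at h2
    obtain ⟨a, b, c, d, e⟩ := h2 h1
    exact ⟨a, b, c, d, fun k hk hk' => or_iff_not_imp_left.2 fun hn => e k hk hk' (not_lt.1 hn)⟩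
  · rintro ⟨a, b, c, d, e⟩
    refine ⟨⟨a.le, b.le, c.le, d.le, fun k hk hk' => (e k hk hk').imp le_of_lt le_of_lt⟩, ?_⟩
    rintro ⟨-, h | h | h | h | ⟨k, hk, hk', h, h'⟩⟩
    · exact h.not_gt a
    · exact h.not_gt b
    · exact h.not_gt c
    · exact h.not_gt d
    · exact (e k hk hk').elim h.not_gt h'.not_gt

/-- Each upper bound is at least `1`, so the point `(1/2, 1/2)` satisfies all constraints strictly
and the staircase is star-shaped about it. Both regularity and connectedness of the interior follow.
-/
lemma openSegment_subset_interior_staircase (hp : p ∈ staircase R) :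
    openSegment ℝ ((1 / 2 : ℝ), (1 / 2 : ℝ)) p ⊆ interior (staircase R) := by
  rintro _ ⟨a, b, ha, hb, hab, rfl⟩
  rw [mem_staircase_iff_forall] at hp
  obtain ⟨h1, h2, h3, h4, h5⟩ := hp
  have hR : (0 : ℝ) ≤ R := R.cast_nonneg
  have lower : ∀ u : ℝ, 0 ≤ u → 0 < a * (1 / 2) + b * u := fun u hu => by positivity
  have upper : ∀ u c : ℝ, 1 ≤ c → u ≤ c → a * (1 / 2) + b * u < c := by
    intro u c hc hu
    nlinarith
  rw [mem_interior_staircase]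
  simp only [Prod.fst_add, Prod.smul_fst, Prod.snd_add, Prod.smul_snd, smul_eq_mul]
  refine ⟨lower _ h1, lower _ h2, upper _ _ (by linarith) h3, upper _ _ (by linarith) h4,
    fun k hk hk' => ?_⟩
  have hk1 : (1 : ℝ) ≤ k := by exact_mod_cast hk
  have hk2 : (k : ℝ) ≤ R := by exact_mod_cast hk'
  exact (h5 k hk hk').imp (upper _ _ hk1) (upper _ _ (by linarith))

lemma closure_interior_staircase (R : ℕ) : closure (interior (staircase R)) = staircase R := by
  refine ((isCompact_staircase R).isClosed.closure_interior_subset).antisymm fun p hp => ?_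
  exact closure_mono (openSegment_subset_interior_staircase hp)
    (segment_subset_closure_openSegment (right_mem_segment ℝ _ _))

lemma isConnected_interior_staircase (R : ℕ) : IsConnected (interior (staircase R)) := by
  have hc : ((1 / 2 : ℝ), (1 / 2 : ℝ)) ∈ interior (staircase R) := by
    rw [mem_interior_staircase]
    have hR : (0 : ℝ) ≤ R := R.cast_nonneg
    refine ⟨by norm_num, by norm_num, by norm_num; linarith, by norm_num; linarith,
      fun k hk _ => Or.inl ?_⟩
    have hk1 : (1 : ℝ) ≤ k := by exact_mod_cast hk
    norm_num
    linarith
  refine (StarConvex.isPathConnected ?_ hc).isConnected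
  rw [starConvex_iff_openSegment_subset hc]
  exact fun p hp => openSegment_subset_interior_staircase (interior_subset hp)

/-- The vertices of the staircase in cyclic order, starting with the origin. -/
noncomputable def staircaseVertex (R m : ℕ) : ℝ × ℝ :=
  if m = 0 then (0, 0) else ((R : ℝ) + 1 - ((m - 1) / 2 : ℕ), ((m / 2 : ℕ) : ℝ))

/-- The boundary of the staircase as a polygon. -/
noncomputable def staircasePolygon (R : ℕ) : Polygon (ℝ × ℝ) (2 * R + 4) :=
  ⟨fun i => staircaseVertex R i⟩

lemma staircaseVertex_zero : staircaseVertex R 0 = (0, 0) := rfl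

lemma staircaseVertex_odd (k : ℕ) : staircaseVertex R (2 * k + 1) = ((R : ℝ) + 1 - k, (k : ℝ)) := by
  have h1 : (2 * k + 1 - 1) / 2 = k := by omega
  have h2 : (2 * k + 1) / 2 = k := by omega
  rw [staircaseVertex, if_neg (by omega), h1, h2]

lemma staircaseVertex_even (k : ℕ) :
    staircaseVertex R (2 * k + 2) = ((R : ℝ) + 1 - k, (k : ℝ) + 1) := by
  have h1 : (2 * k + 2 - 1) / 2 = k := by omega
  have h2 : (2 * k + 2) / 2 = k + 1 := by omega
  rw [staircaseVertex, if_neg (by omega), h1, h2]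
  push_cast
  rfl

lemma staircaseVertex_odd_succ (k : ℕ) :
    staircaseVertex R (2 * k + 2 + 1) = ((R : ℝ) - k, (k : ℝ) + 1) := by
  rw [show 2 * k + 2 + 1 = 2 * (k + 1) + 1 by ring, staircaseVertex_odd]
  push_cast
  congr 1
  ring

lemma val_finRotate (i : Fin (2 * R + 4)) :
    (finRotate (2 * R + 4) i : ℕ) = if (i : ℕ) = 2 * R + 3 then 0 else (i : ℕ) + 1 := by
  rw [coe_finRotate]
  simp [Fin.ext_iff]

lemma staircase_index_cases {m : ℕ} (hm : m < 2 * R + 4) :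
    m = 0 ∨ (∃ k ≤ R, m = 2 * k + 1) ∨ (∃ k ≤ R, m = 2 * k + 2) ∨ m = 2 * R + 3 := by
  rcases Nat.even_or_odd' m with ⟨k, rfl | rfl⟩
  · rcases k with _ | k
    · exact Or.inl rfl
    · exact Or.inr (Or.inr (Or.inl ⟨k, by omega, by ring⟩))
  · rcases Nat.lt_or_ge R k with h | h
    · exact Or.inr (Or.inr (Or.inr (by omega)))
    · exact Or.inr (Or.inl ⟨k, h, rfl⟩)

lemma mem_affineSegment_horizontal {a a' b : ℝ} :
    p ∈ affineSegment ℝ (a, b) (a', b) ↔ p.1 ∈ uIcc a a' ∧ p.2 = b := by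
  rw [affineSegment_eq_segment, ← Prod.image_mk_segment_left, segment_eq_uIcc]
  constructor
  · rintro ⟨u, hu, rfl⟩
    exact ⟨hu, rfl⟩
  · rintro ⟨h, rfl⟩
    exact ⟨p.1, h, rfl⟩

lemma mem_affineSegment_vertical {a b b' : ℝ} :
    p ∈ affineSegment ℝ (a, b) (a, b') ↔ p.1 = a ∧ p.2 ∈ uIcc b b' := by
  rw [affineSegment_eq_segment, ← Prod.image_mk_segment_right, segment_eq_uIcc]
  constructor
  · rintro ⟨u, hu, rfl⟩
    exact ⟨rfl, hu⟩
  · rintro ⟨rfl, h⟩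
    exact ⟨p.2, h, rfl⟩

/-- The chain runs counterclockwise: the bottom, then alternating vertical and horizontal edges
climbing from the right, then the left side. Thus `k` counts stairs from the right, opposite to the
index in `staircase`. -/
lemma mem_edgeSet_staircasePolygon (i : Fin (2 * R + 4)) :
    p ∈ (staircasePolygon R).edgeSet ℝ i ↔
      ((i : ℕ) = 0 ∧ (0 ≤ p.1 ∧ p.1 ≤ R + 1) ∧ p.2 = 0) ∨
      (∃ k ≤ R, (i : ℕ) = 2 * k + 1 ∧ p.1 = R + 1 - k ∧ (k : ℝ) ≤ p.2 ∧ p.2 ≤ k + 1) ∨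
      (∃ k ≤ R, (i : ℕ) = 2 * k + 2 ∧ ((R : ℝ) - k ≤ p.1 ∧ p.1 ≤ R + 1 - k) ∧ p.2 = k + 1) ∨
      ((i : ℕ) = 2 * R + 3 ∧ p.1 = 0 ∧ 0 ≤ p.2 ∧ p.2 ≤ R + 1) := by
  have hR : (0 : ℝ) ≤ (R : ℝ) + 1 := by positivity
  have hedge : (staircasePolygon R).edgeSet ℝ i = affineSegment ℝ (staircaseVertex R i)
      (staircaseVertex R (if (i : ℕ) = 2 * R + 3 then 0 else (i : ℕ) + 1)) := by
    rw [← val_finRotate]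
    rfl
  rw [hedge]
  rcases staircase_index_cases i.2 with h | ⟨k, hk, h⟩ | ⟨k, hk, h⟩ | h <;> rw [h]
  · rw [if_neg (by omega), staircaseVertex_zero, show 0 + 1 = 2 * 0 + 1 from rfl,
      staircaseVertex_odd]
    simp only [Nat.cast_zero, sub_zero]
    rw [mem_affineSegment_horizontal, uIcc_of_le hR]
    refine ⟨fun h => Or.inl ⟨trivial, h⟩, ?_⟩
    rintro (⟨-, h⟩ | ⟨k, -, h, -⟩ | ⟨k, -, h, -⟩ | ⟨h, -⟩)
    · exact h
    all_goals omega
  · rw [if_neg (by omega), staircaseVertex_odd, show 2 * k + 1 + 1 = 2 * k + 2 from rfl,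
      staircaseVertex_even, mem_affineSegment_vertical, uIcc_of_le (by linarith)]
    refine ⟨fun h => Or.inr (Or.inl ⟨k, hk, rfl, h⟩), ?_⟩
    rintro (⟨h, -⟩ | ⟨l, -, h, h'⟩ | ⟨l, -, h, -⟩ | ⟨h, -⟩)
    · omega
    · obtain rfl : k = l := by omega
      exact h'
    all_goals omega
  · rw [if_neg (by omega), staircaseVertex_even, staircaseVertex_odd_succ,
      mem_affineSegment_horizontal, uIcc_of_ge (by linarith)]
    refine ⟨fun h => Or.inr (Or.inr (Or.inl ⟨k, hk, rfl, h⟩)), ?_⟩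
    rintro (⟨h, -⟩ | ⟨l, -, h, -⟩ | ⟨l, -, h, h'⟩ | ⟨h, -⟩)
    · omega
    · omega
    · obtain rfl : k = l := by omega
      exact h'
    · omega
  · rw [if_pos rfl, staircaseVertex_zero, show 2 * R + 3 = 2 * R + 2 + 1 from rfl,
      staircaseVertex_odd_succ, sub_self, mem_affineSegment_vertical, uIcc_of_ge hR]
    refine ⟨fun h => Or.inr (Or.inr (Or.inr ⟨rfl, h⟩)), ?_⟩
    rintro (⟨h, -⟩ | ⟨l, hl, h, -⟩ | ⟨l, hl, h, -⟩ | ⟨-, h⟩)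
    · omega
    · omega
    · omega
    · exact h

lemma frontier_staircase (R : ℕ) : frontier (staircase R) = (staircasePolygon R).boundary ℝ := by
  have hR : (0 : ℝ) ≤ R := R.cast_nonneg
  ext p
  rw [mem_frontier_staircase, Polygon.boundary, mem_iUnion]
  simp only [mem_edgeSet_staircasePolygon]
  constructor
  · rintro ⟨hp, h⟩
    obtain ⟨k, hk, h1, h2, h3, h4⟩ := mem_staircase.1 hp
    have hk' : (k : ℝ) ≤ R := by exact_mod_cast hk
    have hk0 : (0 : ℝ) ≤ k := k.cast_nonneg
    rcases h with h | h | h | h | ⟨l, hl1, hlR, h5, h6⟩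
    · exact ⟨⟨2 * R + 3, by omega⟩, Or.inr (Or.inr (Or.inr ⟨rfl, by linarith, h3, by linarith⟩))⟩
    · exact ⟨⟨0, by omega⟩, Or.inl ⟨rfl, ⟨h1, by linarith⟩, by linarith⟩⟩
    · refine ⟨⟨2 * 0 + 1, by omega⟩, Or.inr (Or.inl ⟨0, Nat.zero_le _, rfl, ?_⟩)⟩
      push_cast
      exact ⟨by linarith, h3, by linarith⟩
    · refine ⟨⟨2 * R + 2, by omega⟩, Or.inr (Or.inr (Or.inl ⟨R, le_rfl, rfl, ?_⟩))⟩
      exact ⟨⟨by linarith, by linarith⟩, by linarith⟩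
    -- A point of stair `k` in the closed quadrant at inner corner `l` lies on the top of the stair
    -- (`l = k`) or on its right side (`l = k + 1`).
    · have a1 : l ≤ k + 1 := by
        have : (l : ℝ) ≤ k + 1 := by linarith
        exact_mod_cast this
      have a2 : k ≤ l := by
        have : (k : ℝ) ≤ l := by linarith
        exact_mod_cast this
      obtain rfl | rfl : k = l ∨ l = k + 1 := by omega
      · obtain ⟨m, rfl⟩ := Nat.exists_eq_add_of_le hlR
        refine ⟨⟨2 * m + 2, by omega⟩, Or.inr (Or.inr (Or.inl ⟨m, by omega, rfl, ?_⟩))⟩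
        push_cast at *
        exact ⟨⟨by linarith, by linarith⟩, by linarith⟩
      · obtain ⟨m, rfl⟩ := Nat.exists_eq_add_of_le hlR
        refine ⟨⟨2 * (m + 1) + 1, by omega⟩, Or.inr (Or.inl ⟨m + 1, by omega, rfl, ?_⟩)⟩
        push_cast at *
        exact ⟨by linarith, by linarith, by linarith⟩
  · rintro ⟨i, ⟨-, ⟨h1, h2⟩, h3⟩ | ⟨k, hk, -, h1, h2, h3⟩ | ⟨k, hk, -, ⟨h1, h2⟩, h3⟩ |
      ⟨-, h1, h2, h3⟩⟩
    · refine ⟨mem_staircase.2 ⟨R, le_rfl, h1, h2, h3.ge, by linarith⟩, Or.inr (Or.inl h3.le)⟩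
    · obtain ⟨m, rfl⟩ := Nat.exists_eq_add_of_le hk
      have hk0 : (0 : ℝ) ≤ k := k.cast_nonneg
      have hm0 : (0 : ℝ) ≤ m := m.cast_nonneg
      push_cast at *
      refine ⟨mem_staircase.2 ⟨m, by omega, by linarith, by linarith, by linarith,
        by push_cast; linarith⟩, ?_⟩
      rcases Nat.eq_zero_or_pos k with rfl | hk1
      · refine Or.inr (Or.inr (Or.inl ?_))
        push_cast at *
        linarith
      · refine Or.inr (Or.inr (Or.inr (Or.inr ⟨m + 1, by omega, by omega, ?_, ?_⟩))) <;>
          push_cast <;> linarith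
    · obtain ⟨m, rfl⟩ := Nat.exists_eq_add_of_le hk
      have hk0 : (0 : ℝ) ≤ k := k.cast_nonneg
      have hm0 : (0 : ℝ) ≤ m := m.cast_nonneg
      push_cast at *
      refine ⟨mem_staircase.2 ⟨m, by omega, by linarith, by linarith, by linarith,
        by push_cast; linarith⟩, ?_⟩
      rcases Nat.eq_zero_or_pos m with rfl | hm1
      · refine Or.inr (Or.inr (Or.inr (Or.inl ?_)))
        push_cast at *
        linarith
      · refine Or.inr (Or.inr (Or.inr (Or.inr ⟨m, hm1, by omega, ?_, ?_⟩))) <;> linarith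
    · refine ⟨mem_staircase.2 ⟨0, Nat.zero_le _, h1.ge, ?_, h2, ?_⟩, Or.inl h1.le⟩ <;>
        push_cast <;> linarith

lemma isSimpleRectilinearChain_staircasePolygon (R : ℕ) :
    IsSimpleRectilinearChain (staircasePolygon R) := by
  have hR : (0 : ℝ) ≤ R := R.cast_nonneg
  have hval : ∀ i, staircasePolygon R i = staircaseVertex R i := fun _ => rfl
  refine ⟨fun i => ?_, fun i => ?_, fun i j hij hji hij' => ?_⟩
  · rw [hval, hval, val_finRotate]
    rcases staircase_index_cases i.2 with h | ⟨k, hk, h⟩ | ⟨k, hk, h⟩ | h <;> rw [h]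
    · rw [if_neg (by omega), staircaseVertex_zero, show 0 + 1 = 2 * 0 + 1 from rfl,
        staircaseVertex_odd]
      intro e
      have := (Prod.ext_iff.1 e).1
      simp only [Nat.cast_zero] at this
      linarith
    · rw [if_neg (by omega), staircaseVertex_odd, show 2 * k + 1 + 1 = 2 * k + 2 from rfl,
        staircaseVertex_even]
      intro e
      have := (Prod.ext_iff.1 e).2
      simp at this
    · rw [if_neg (by omega), staircaseVertex_even, staircaseVertex_odd_succ]
      intro e
      have := (Prod.ext_iff.1 e).1
      simp only at this
      linarith
    · rw [if_pos rfl, staircaseVertex_zero, show 2 * R + 3 = 2 * R + 2 + 1 from rfl,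
        staircaseVertex_odd_succ]
      intro e
      have := (Prod.ext_iff.1 e).2
      simp only at this
      linarith
  · rw [hval, hval, hval, val_finRotate (finRotate _ i), val_finRotate]
    rcases staircase_index_cases i.2 with h | ⟨k, hk, h⟩ | ⟨k, hk, h⟩ | h <;> rw [h]
    · right
      rw [if_neg (by omega), if_neg (by omega), staircaseVertex_zero,
        show 0 + 1 = 2 * 0 + 1 from rfl, staircaseVertex_odd,
        show 2 * 0 + 1 + 1 = 2 * 0 + 2 from rfl, staircaseVertex_even]
      simp
    · left
      rw [if_neg (by omega), if_neg (by omega), staircaseVertex_odd,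
        show 2 * k + 1 + 1 = 2 * k + 2 from rfl, staircaseVertex_even, staircaseVertex_odd_succ]
      simp
    · right
      rw [if_neg (by omega), staircaseVertex_even, staircaseVertex_odd_succ]
      rcases Nat.eq_or_lt_of_le hk with rfl | hk
      · rw [if_pos (by omega), staircaseVertex_zero]
        simp
      · rw [if_neg (by omega), show 2 * k + 2 + 1 + 1 = 2 * (k + 1) + 2 by ring,
          staircaseVertex_even]
        refine ⟨rfl, ?_⟩
        push_cast
        ring
    · left
      rw [if_pos rfl, if_neg (by omega), staircaseVertex_zero,
        show 2 * R + 3 = 2 * R + 2 + 1 from rfl, staircaseVertex_odd_succ,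
        show 0 + 1 = 2 * 0 + 1 from rfl, staircaseVertex_odd]
      simp
  · wlog hlt : i < j generalizing i j
    · exact (this j i hij.symm hij' hji (lt_of_le_of_ne (not_lt.1 hlt) hij.symm)).symm
    rw [Fin.lt_def] at hlt
    rw [Ne, Fin.ext_iff, val_finRotate] at hji hij'
    have hi := i.2
    have hj := j.2
    rw [disjoint_left]
    intro q hqi hqj
    rw [mem_edgeSet_staircasePolygon] at hqi hqj
    -- Comparing coordinates at a common point confines the stair indices so tightly that the two
    -- edges would be equal or cyclically consecutive.
    have cast_le : ∀ a b : ℕ, (a : ℝ) ≤ b → a ≤ b := fun a b h => by exact_mod_cast h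
    rcases hqi with ⟨hi', h1, h2⟩ | ⟨k, hk, hi', h1, h2, h3⟩ | ⟨k, hk, hi', ⟨h1, h2⟩, h3⟩ | ⟨hi', -⟩
    · rcases hqj with ⟨hj', -⟩ | ⟨l, -, hj', g1, g2, g3⟩ | ⟨l, -, hj', -, g3⟩ | ⟨hj', -⟩
      · omega
      · have := cast_le l 0 (by push_cast; linarith)
        simp only [hi', hj'] at hji
        split_ifs at hji <;> omega
      · have : (0 : ℝ) ≤ l := l.cast_nonneg
        linarith
      · simp [hi', hj'] at hij'
    · have hkR : (k : ℝ) ≤ R := by exact_mod_cast hk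
      rcases hqj with ⟨hj', -⟩ | ⟨l, -, hj', g1, g2, g3⟩ | ⟨l, -, hj', ⟨g1, g2⟩, g3⟩ | ⟨hj', g1, -⟩
      · omega
      · have := cast_le k l (by linarith)
        have := cast_le l k (by linarith)
        omega
      · have := cast_le l k (by linarith)
        have := cast_le k (l + 1) (by push_cast; linarith)
        simp only [hi', hj'] at hji
        split_ifs at hji <;> omega
      · linarith
    · rcases hqj with ⟨hj', -⟩ | ⟨l, -, hj', g1, g2, g3⟩ | ⟨l, -, hj', ⟨g1, g2⟩, g3⟩ | ⟨hj', g1, -⟩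
      · omega
      · have := cast_le l (k + 1) (by push_cast; linarith)
        simp only [hi', hj'] at hji
        split_ifs at hji <;> omega
      · have := cast_le k l (by linarith)
        have := cast_le l k (by linarith)
        omega
      · have := cast_le R k (by linarith)
        simp only [hi', hj'] at hji
        split_ifs at hji <;> omega
    · omega

theorem isRectilinearPolygon_staircase (R : ℕ) : IsRectilinearPolygon (staircase R) :=
  ⟨isCompact_staircase R, closure_interior_staircase R, isConnected_interior_staircase R,
    2 * R + 4, staircasePolygon R, isSimpleRectilinearChain_staircasePolygon R,
    frontier_staircase R⟩

end Staircase

/-! ### Reflex vertices of the staircase -/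

section StaircaseReflex

variable {R : ℕ}

lemma staircase_of_le {p q : ℝ × ℝ} (hp : p ∈ staircase R) (h1 : 0 ≤ q.1) (h2 : 0 ≤ q.2)
    (h3 : q.1 ≤ p.1) (h4 : q.2 ≤ p.2) : q ∈ staircase R := by
  rw [mem_staircase] at *
  obtain ⟨k, hk, -, a, -, b⟩ := hp
  exact ⟨k, hk, h1, h3.trans a, h2, h4.trans b⟩

lemma exists_pos_of_eventually_nhds {p : ℝ × ℝ} {P : ℝ × ℝ → Prop} (h : ∀ᶠ q in 𝓝 p, P q) :
    ∃ ε > 0, ∀ a b : ℝ, |a| ≤ ε → |b| ≤ ε → P (p.1 + a, p.2 + b) := by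
  obtain ⟨ε, hε, hP⟩ := Metric.eventually_nhds_iff.1 h
  refine ⟨ε / 2, half_pos hε, fun a b ha hb => hP ?_⟩
  rw [Prod.dist_eq, max_lt_iff]
  simp only [Real.dist_eq, add_sub_cancel_left]
  constructor <;> linarith

/-- The staircase is downward closed in the positive quadrant, so the missing quadrant at a reflex
vertex `p` must point up and right. Points just right of `p` and just above `p` lie in stairs `k`
and `l`. As neither stair may enter the missing quadrant, `p.2` is the top of stair `k` and `p.1`
the right end of stair `l`. If `k` exceeded `l + 1`, stair `l + 1` would enter that quadrant. -/
lemma reflexVertices_staircase (R : ℕ) :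
    reflexVertices (staircase R) = (fun k : ℕ => ((k : ℝ), (R : ℝ) + 1 - k)) '' Icc 1 R := by
  ext p
  constructor
  · rintro ⟨s, t, hs, ht, h⟩
    obtain ⟨ε, hε, H⟩ := exists_pos_of_eventually_nhds h
    have he : |ε| ≤ ε := (abs_of_pos hε).le
    have hts : |t * ε| ≤ ε ∧ |-(t * ε)| ≤ ε := by
      rw [abs_neg]
      rcases ht with rfl | rfl <;> simpa using he
    have hss : |s * ε| ≤ ε ∧ |-(s * ε)| ≤ ε := by
      rw [abs_neg]
      rcases hs with rfl | rfl <;> simpa using he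
    have hs2 : s * s = 1 := by rcases hs with rfl | rfl <;> norm_num
    have ht2 : t * t = 1 := by rcases ht with rfl | rfl <;> norm_num
    have mpm : (p.1 + s * ε, p.2 + -(t * ε)) ∈ staircase R :=
      (H _ _ hss.1 hts.2).2 (Or.inl (by simp only; nlinarith))
    have mmp : (p.1 + -(s * ε), p.2 + t * ε) ∈ staircase R :=
      (H _ _ hss.2 hts.1).2 (Or.inr (by simp only; nlinarith))
    have mmm : (p.1 + -(s * ε), p.2 + -(t * ε)) ∉ staircase R := by
      rw [H _ _ hss.2 hts.2]
      simp only [not_or, not_le]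
      constructor <;> nlinarith
    have nn1 := (mem_staircase_iff_forall.1 mmp).1
    have nn2 := (mem_staircase_iff_forall.1 mpm).2.1
    obtain rfl : s = -1 := by
      refine hs.resolve_left ?_
      rintro rfl
      exact mmm (staircase_of_le mpm nn1 nn2 (by simp only; linarith) le_rfl)
    obtain rfl : t = -1 := by
      refine ht.resolve_left ?_
      rintro rfl
      exact mmm (staircase_of_le mmp nn1 nn2 le_rfl (by simp only; linarith))
    have hout : ∀ a b : ℝ, 0 < a → a ≤ ε → 0 < b → b ≤ ε → (p.1 + a, p.2 + b) ∉ staircase R := by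
      intro a b ha ha' hb hb'
      rw [H a b (by rwa [abs_of_pos ha]) (by rwa [abs_of_pos hb])]
      simp only [not_or, not_le]
      constructor <;> linarith
    have hx : (p.1 + ε, p.2 + 0) ∈ staircase R :=
      (H _ _ he (by simpa using hε.le)).2 (Or.inr (by simp))
    have hy : (p.1 + 0, p.2 + ε) ∈ staircase R :=
      (H _ _ (by simpa using hε.le) he).2 (Or.inl (by simp))
    obtain ⟨k, hk, k1, k2, k3, k4⟩ := mem_staircase.1 hx
    obtain ⟨l, hl, l1, l2, l3, l4⟩ := mem_staircase.1 hy
    simp only [add_zero] at k1 k2 k3 k4 l1 l2 l3 l4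
    have ek : p.2 = (R : ℝ) + 1 - k := by
      by_contra hne
      have hlt : 0 < (R : ℝ) + 1 - k - p.2 := sub_pos.2 (lt_of_le_of_ne k4 hne)
      refine hout ε (min ε ((R : ℝ) + 1 - k - p.2)) hε le_rfl (lt_min hε hlt) (min_le_left _ _)
        (mem_staircase.2 ⟨k, hk, k1, k2, ?_, ?_⟩)
      · have := lt_min hε hlt
        simp only
        linarith
      · have := min_le_right ε ((R : ℝ) + 1 - k - p.2)
        simp only
        linarith
    have el : p.1 = (l : ℝ) + 1 := by
      by_contra hne
      have hlt : 0 < (l : ℝ) + 1 - p.1 := sub_pos.2 (lt_of_le_of_ne l2 hne)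
      refine hout (min ε ((l : ℝ) + 1 - p.1)) ε (lt_min hε hlt) (min_le_left _ _) hε le_rfl
        (mem_staircase.2 ⟨l, hl, ?_, ?_, l3, l4⟩)
      · have := lt_min hε hlt
        simp only
        linarith
      · have := min_le_right ε ((l : ℝ) + 1 - p.1)
        simp only
        linarith
    have hlk : l + 1 ≤ k := by
      have : (l : ℝ) < k := by linarith
      exact_mod_cast this
    have hkl : k = l + 1 := by
      by_contra hne
      have h2 : l + 2 ≤ k := by omega
      have h2' : (l : ℝ) + 2 ≤ k := by exact_mod_cast h2
      have hδ : 0 < min ε 1 := lt_min hε one_pos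
      have hδ1 : min ε 1 ≤ 1 := min_le_right _ _
      refine hout (min ε 1) (min ε 1) hδ (min_le_left _ _) hδ (min_le_left _ _)
        (mem_staircase.2 ⟨l + 1, by omega, ?_, ?_, ?_, ?_⟩) <;> push_cast <;> linarith
    refine ⟨k, ⟨by omega, hk⟩, Prod.ext ?_ ek.symm⟩
    rw [el, hkl]
    push_cast
    rfl
  · rintro ⟨k, ⟨hk1, hkR⟩, rfl⟩
    have hk1' : (1 : ℝ) ≤ k := by exact_mod_cast hk1
    have hkR' : (k : ℝ) ≤ R := by exact_mod_cast hkR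
    refine ⟨-1, -1, Or.inr rfl, Or.inr rfl, ?_⟩
    have hN : Ioo ((k : ℝ) - 1) (k + 1) ×ˢ Ioo ((R : ℝ) - k) (R + 2 - k) ∈
        𝓝 ((k : ℝ), (R : ℝ) + 1 - k) :=
      prod_mem_nhds (Ioo_mem_nhds (by linarith) (by linarith))
        (Ioo_mem_nhds (by linarith) (by linarith))
    filter_upwards [hN] with q ⟨⟨h1, h2⟩, h3, h4⟩
    constructor
    · intro hq
      rcases (mem_staircase_iff_forall.1 hq).2.2.2.2 k hk1 hkR with h | h
      · left
        linarith
      · right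
        linarith
    · rintro (h | h)
      · obtain ⟨l, rfl⟩ := Nat.exists_eq_add_of_le' hk1
        push_cast at *
        exact mem_staircase.2 ⟨l, by omega, by linarith, by linarith, by linarith, by linarith⟩
      · exact mem_staircase.2 ⟨k, hkR, by linarith, by linarith, by linarith, by linarith⟩

lemma encard_reflexVertices_staircase (R : ℕ) : (reflexVertices (staircase R)).encard = R := by
  have hinj : Function.Injective fun k : ℕ => ((k : ℝ), (R : ℝ) + 1 - k) := by
    intro k l h
    exact Nat.cast_injective (R := ℝ) (Prod.ext_iff.1 h).1
  rw [reflexVertices_staircase, hinj.encard_image, ← Finset.coe_Icc, encard_coe_eq_coe_finsetCard,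
    Nat.card_Icc, Nat.add_sub_cancel]

end StaircaseReflex

/-! ### A density attaining the bound -/

section StaircaseDensity

/-- The open unit square at the `k`-th outer corner of the staircase. -/
def cornerCell (R k : ℕ) : Set (ℝ × ℝ) :=
  Ioo (k : ℝ) (k + 1) ×ˢ Ioo ((R : ℝ) - k) (R + 1 - k)

/-- The weight of the `k`-th corner: `n` for the last one and `1` for all others. -/
def cornerWeight (n R k : ℕ) : ℝ := if k = R then n else 1

/-- The density that is constant on each corner cell of the staircase. -/
noncomputable def cornerDensity (n R : ℕ) (p : ℝ × ℝ) : ℝ :=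
  ∑ k ∈ Finset.range (R + 1), (cornerCell R k).indicator (fun _ => cornerWeight n R k) p

variable {n R : ℕ}

lemma measurableSet_cornerCell (R k : ℕ) : MeasurableSet (cornerCell R k) :=
  measurableSet_Ioo.prod measurableSet_Ioo

lemma volume_cornerCell (R k : ℕ) : volume (cornerCell R k) = 1 := by
  rw [cornerCell, Measure.volume_eq_prod, Measure.prod_prod, Real.volume_Ioo, Real.volume_Ioo]
  have h1 : (k : ℝ) + 1 - k = 1 := by ring
  have h2 : (R : ℝ) + 1 - k - (R - k) = 1 := by ring
  rw [h1, h2, ENNReal.ofReal_one, one_mul]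

lemma cornerWeight_nonneg (n R k : ℕ) : 0 ≤ cornerWeight n R k := by
  unfold cornerWeight
  split_ifs <;> positivity

lemma integrable_cornerDensity (n R : ℕ) : Integrable (cornerDensity n R) := by
  refine integrable_finsetSum _ fun k _ => ?_
  refine (integrable_indicator_iff (measurableSet_cornerCell R k)).2 (integrableOn_const ?_)
  simp [volume_cornerCell]

lemma isValueDensity_cornerDensity (n R : ℕ) (C : Set (ℝ × ℝ)) :
    IsValueDensity C (cornerDensity n R) := by
  refine ⟨(integrable_cornerDensity n R).integrableOn, fun p _ => ?_,
    ∑ k ∈ Finset.range (R + 1), cornerWeight n R k, fun p _ => ?_⟩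
  · exact Finset.sum_nonneg fun k _ => indicator_nonneg (fun _ _ => cornerWeight_nonneg n R k) p
  · exact Finset.sum_le_sum fun k _ => indicator_le_self' (fun _ _ => cornerWeight_nonneg n R k) p

lemma pieceValue_cornerDensity (X : Set (ℝ × ℝ)) :
    pieceValue (cornerDensity n R) X =
      ∑ k ∈ Finset.range (R + 1), cornerWeight n R k * volume.real (X ∩ cornerCell R k) := by
  unfold pieceValue cornerDensity
  rw [integral_finsetSum]
  · refine Finset.sum_congr rfl fun k _ => ?_
    rw [integral_indicator_const _ (measurableSet_cornerCell R k), smul_eq_mul, mul_comm,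
      measureReal_restrict_apply (measurableSet_cornerCell R k), inter_comm]
  · intro k _
    refine ((integrable_indicator_iff (measurableSet_cornerCell R k)).2
      (integrableOn_const ?_)).integrableOn
    simp [volume_cornerCell]

lemma cornerCell_subset_staircase {k : ℕ} (hk : k ≤ R) : cornerCell R k ⊆ staircase R := by
  rintro p ⟨⟨h1, h2⟩, h3, h4⟩
  have hk' : (k : ℝ) ≤ R := by exact_mod_cast hk
  have hk0 : (0 : ℝ) ≤ k := k.cast_nonneg
  exact mem_staircase.2 ⟨k, hk, by linarith, h2.le, by linarith, h4.le⟩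

lemma pieceValue_cornerDensity_staircase (n R : ℕ) :
    pieceValue (cornerDensity n R) (staircase R) = (n : ℝ) + R := by
  have : ∀ k ∈ Finset.range (R + 1),
      cornerWeight n R k * volume.real (staircase R ∩ cornerCell R k) = cornerWeight n R k := by
    intro k hk
    rw [inter_eq_right.2 (cornerCell_subset_staircase (Nat.lt_succ_iff.1 (Finset.mem_range.1 hk))),
      Measure.real, volume_cornerCell, ENNReal.toReal_one, mul_one]
  rw [pieceValue_cornerDensity, Finset.sum_congr rfl this, Finset.sum_range_succ,
    Finset.sum_congr rfl fun k hk =>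
      show cornerWeight n R k = 1 from if_neg (Finset.mem_range.1 hk).ne]
  simp [cornerWeight, add_comm]

lemma volume_real_inter_cornerCell_le (X : Set (ℝ × ℝ)) (k : ℕ) :
    volume.real (X ∩ cornerCell R k) ≤ 1 := by
  have h : volume.real (cornerCell R k) = 1 := by
    rw [Measure.real, volume_cornerCell, ENNReal.toReal_one]
  rw [← h]
  exact measureReal_mono inter_subset_right (by simp [volume_cornerCell])

/-- A rectangle in the staircase cannot reach into two corner cells. -/
lemma IsRectangle.eq_of_nonempty_inter_cornerCell {X : Set (ℝ × ℝ)} (hX : IsRectangle X)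
    (hXC : X ⊆ staircase R) {k l : ℕ} (hk : (X ∩ cornerCell R k).Nonempty)
    (hl : (X ∩ cornerCell R l).Nonempty) : k = l := by
  wlog hlt : k < l generalizing k l
  · rcases Nat.lt_or_ge l k with h | h
    · exact (this hl hk h).symm
    · exact le_antisymm h (not_lt.1 hlt)
  obtain ⟨I, J, -, -, -, -, rfl⟩ := hX
  obtain ⟨p, ⟨hpI, hpJ⟩, ⟨h1, h2⟩, h3, h4⟩ := hk
  obtain ⟨q, ⟨hqI, hqJ⟩, ⟨g1, g2⟩, g3, g4⟩ := hl
  -- The rectangle also contains the mixed point `(q.1, p.2)`. A stair `m` containing it would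
  -- satisfy `l ≤ m ≤ k`, against `k < l`.
  obtain ⟨m, hm, -, m2, -, m4⟩ := mem_staircase.1 (hXC (show (q.1, p.2) ∈ I ×ˢ J from ⟨hqI, hpJ⟩))
  simp only at m2 m4
  have a1 : (l : ℝ) < m + 1 := by linarith
  have a2 : (m : ℝ) < k + 1 := by linarith
  have a1' : l < m + 1 := by exact_mod_cast a1
  have a2' : m < k + 1 := by exact_mod_cast a2
  omega

lemma IsRectangle.measurableSet {X : Set (ℝ × ℝ)} (hX : IsRectangle X) : MeasurableSet X := by
  obtain ⟨I, J, hI, hJ, -, -, rfl⟩ := hX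
  exact hI.measurableSet.prod hJ.measurableSet

/-- A rectangle worth more than one gets all its value from the last corner. -/
lemma IsRectangle.pieceValue_cornerDensity_eq {X : Set (ℝ × ℝ)} (hX : IsRectangle X)
    (hXC : X ⊆ staircase R) (hv : 1 < pieceValue (cornerDensity n R) X) :
    pieceValue (cornerDensity n R) X = n * volume.real (X ∩ cornerCell R R) := by
  have hone : ∀ k ∈ Finset.range (R + 1), (X ∩ cornerCell R k).Nonempty →
      pieceValue (cornerDensity n R) X = cornerWeight n R k * volume.real (X ∩ cornerCell R k) := by
    intro k hk hne
    rw [pieceValue_cornerDensity]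
    refine Finset.sum_eq_single_of_mem k hk fun l _ hl => ?_
    have : X ∩ cornerCell R l = ∅ := by
      by_contra h
      exact hl (hX.eq_of_nonempty_inter_cornerCell hXC (nonempty_iff_ne_empty.2 h) hne)
    rw [this, measureReal_empty, mul_zero]
  obtain ⟨k, hk, hne⟩ : ∃ k ∈ Finset.range (R + 1), (X ∩ cornerCell R k).Nonempty := by
    by_contra! h
    rw [pieceValue_cornerDensity, Finset.sum_eq_zero] at hv
    · linarith
    · intro k hk
      rw [h k hk, measureReal_empty, mul_zero]
  have hval := hone k hk hne
  by_cases hkR : k = R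
  · subst hkR
    rw [hval, cornerWeight, if_pos rfl]
  · rw [hval, cornerWeight, if_neg hkR, one_mul] at hv
    exact absurd (volume_real_inter_cornerCell_le X k) hv.not_ge

/-- If all agents have the corner density, some agent gets at most the value one. -/
theorem exists_pieceValue_cornerDensity_le (hn : 1 ≤ n) {X : Fin n → Set (ℝ × ℝ)}
    (hX : IsRectangularAllocation (staircase R) X) :
    ∃ i, pieceValue (cornerDensity n R) (X i) ≤ 1 := by
  by_contra! H
  have : NeZero n := ⟨by omega⟩
  have hsum : (n : ℝ) < ∑ i, pieceValue (cornerDensity n R) (X i) := by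
    calc (n : ℝ) = ∑ _i : Fin n, (1 : ℝ) := by simp
      _ < _ := Finset.sum_lt_sum_of_nonempty Finset.univ_nonempty fun i _ => H i
  rw [Finset.sum_congr rfl fun i _ =>
    (hX.rectangle i).pieceValue_cornerDensity_eq (hX.subset i) (H i), ← Finset.mul_sum] at hsum
  -- The pieces are disjoint, so their areas in the last corner square add up to at most one, and
  -- their values to at most `n`.
  have hU : ∑ i, volume.real (X i ∩ cornerCell R R) =
      volume.real ((⋃ i, X i) ∩ cornerCell R R) := by
    have hfin : ∀ i, volume (X i ∩ cornerCell R R) ≠ ⊤ := fun i =>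
      measure_ne_top_of_subset inter_subset_right (by simp [volume_cornerCell])
    rw [iUnion_inter, measureReal_iUnion_fintype _ _ hfin]
    · exact fun i j hij => (hX.disjoint i j hij).mono inter_subset_left inter_subset_left
    · exact fun i => (hX.rectangle i).measurableSet.inter (measurableSet_cornerCell R R)
  rw [hU] at hsum
  have := mul_le_of_le_one_right (Nat.cast_nonneg (α := ℝ) n)
    (volume_real_inter_cornerCell_le (R := R) (⋃ i, X i) R)
  linarith

end StaircaseDensity

theorem mainTheorem8 (n : ℕ) (hn : 1 ≤ n) (R : ℕ) :
    IsGreatest {c : ℝ | CanGuarantee n R c} (1 / ((n : ℝ) + (R : ℝ))) ∧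
    (IsRectilinearPolygon (staircase R) ∧ (reflexVertices (staircase R)).encard = R ∧
      ∃ w : ℝ × ℝ → ℝ, IsValueDensity (staircase R) w ∧ 0 < pieceValue w (staircase R) ∧
        ∀ X : Fin n → Set (ℝ × ℝ), IsRectangularAllocation (staircase R) X →
          ∃ i, pieceValue w (X i) ≤ 1 / ((n : ℝ) + (R : ℝ)) * pieceValue w (staircase R)) := by
  have hpos : 0 < (n : ℝ) + (R : ℝ) := by positivity
  have hV := pieceValue_cornerDensity_staircase n R
  refine ⟨⟨canGuarantee_one_div n hn R, fun c hc => ?_⟩, isRectilinearPolygon_staircase R,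
    encard_reflexVertices_staircase R, cornerDensity n R, isValueDensity_cornerDensity n R _,
    by rwa [hV], fun X hX => ?_⟩
  · obtain ⟨X, hX, hXc⟩ := hc (staircase R) (isRectilinearPolygon_staircase R)
      (encard_reflexVertices_staircase R) (fun _ => cornerDensity n R)
      fun _ => isValueDensity_cornerDensity n R _
    obtain ⟨i, hi⟩ := exists_pieceValue_cornerDensity_le hn hX
    rw [le_div_iff₀ hpos, ← hV]
    exact (hXc i).trans hi
  · obtain ⟨i, hi⟩ := exists_pieceValue_cornerDensity_le hn hX
    exact ⟨i, by rwa [hV, one_div_mul_cancel hpos.ne']⟩
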